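/- Let $Q$ be a finite-dimensional smooth manifold, $k\ge 1$, $T^{(k)}Q$ its tangent bundle of order $k$ (classes $[\gamma]_0^{(k)}$ of smooth curves up to contact of order $k$ at time $0$), and, for a curve $\gamma$ in $Q$, let $\gamma^{(k)}(t)=[s\mapsto\gamma(t+s)]_0^{(k)}$ be its $k$-lift. Let $j_k\colon T^{(k)}Q\to TT^{(k-1)}Q$ be the canonical immersion, which sends $[\gamma]_0^{(k)}$ to the velocity of $\gamma^{(k-1)}$ at time $0$, let $\pi\colon T^*TT^{(k-1)}Q\to TT^{(k-1)}Q$ be the projection, and let $\alpha\colon TT^*T^{(k-1)}Q\to T^*TT^{(k-1)}Q$ be the Tulczyjew isomorphism, in natural coordinates $\alpha(q,p,\dot q,\dot p)=(q,\dot q,\dot p,p)$. Let $L\in C^\infty(T^{(k)}Q)$ and put $$\Sigma_L=\{\mu\in T^*TT^{(k-1)}Q \mid j_k^*\mu=dL\},\qquad N_L=\alpha^{-1}(\Sigma_L).$$ (Here $\mu\in\Sigma_L$ means: $\pi(\mu)=j_k(x)$ and $\mu\circ T_xj_k=d_xL$ for some $x\in T^{(k)}Q$.) Let $I\subset\mathbb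 R$ be open (for instance an open interval). A *solution* on $I$ of the $k$th-order Lagrangian system described by $L$ is a smooth curve $\mu\colon I\to T^*TT^{(k-1)}Q$ of the form $\mu=\alpha\circ\frac{d\sigma}{dt}$, where $\sigma\colon I\to T^*T^{(k-1)}Q$ is a smooth curve with $\frac{d\sigma}{dt}(t)\in N_L$ for all $t\in I$. Then: 1. Every solution $\mu$ on $I$ takes its values in $\Sigma_L$, and there is a smooth curve $\gamma\colon I\to Q$ such that $\pi\circ\mu=j_k\circ\gamma^{(k)}$ on $I$. 2. For a smooth curve $\gamma\colon I\to Q$, there is a solution $\mu$ on $I$ with $\pi\circ\mu=j_k\circ\gamma^{(k)}$ if and only if $\gamma$ satisfies on $I$, in all natural charts, the higher-order Euler–Lagrange equations $$\sum_{j=0}^{k}(-1)^j\frac{d^j}{dt^j}\left(\frac{\partial L}{\partial q_{(j)}^i}\bigl(\gamma^{(k)}(t)\bigr)\right)=0 \quad\text{for all } i .$$ 3. For each smooth curve $\gamma\colon I\to Q$ there is at most one solution $\mu$ on $I$ with $\pi\circ\mu=j_k\circ\gamma^{(k)}$. -/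

import Mathlib

open Bundle Set Filter
open scoped Manifold ContDiff Topology

noncomputable section

namespace HigherOrder

/-! ### Two facts of calculus -/

/-- Higher derivatives at a point of a composition depend only on the higher derivatives at this
point of the inner curve. -/
theorem iteratedDeriv_comp_congr {E F : Type*} [NormedAddCommGroup E] [NormedSpace ℝ E]
    [NormedAddCommGroup F] [NormedSpace ℝ F] {f : E → F} {c₁ c₂ : ℝ → E} {t : ℝ} {k : ℕ}
    (h₁ : ContDiffAt ℝ ∞ c₁ t) (h₂ : ContDiffAt ℝ ∞ c₂ t) (hf : ContDiffAt ℝ ∞ f (c₁ t))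
    (h : ∀ j ≤ k, iteratedDeriv j c₁ t = iteratedDeriv j c₂ t) :
    ∀ j ≤ k, iteratedDeriv j (f ∘ c₁) t = iteratedDeriv j (f ∘ c₂) t := by
  intro j hj
  have h0 : c₁ t = c₂ t := by simpa using h 0 (Nat.zero_le _)
  have hj' : ((j : ℕ∞) : WithTop ℕ∞) ≤ ∞ := by exact_mod_cast le_top
  have key : ∀ i ≤ k, iteratedFDeriv ℝ i c₁ t = iteratedFDeriv ℝ i c₂ t := by
    intro i hi
    have := h i hi
    rw [iteratedDeriv_eq_equiv_comp, iteratedDeriv_eq_equiv_comp] at this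
    exact (ContinuousMultilinearMap.piFieldEquiv ℝ (Fin i) E).symm.injective this
  rw [iteratedDeriv_eq_iteratedFDeriv, iteratedDeriv_eq_iteratedFDeriv,
    iteratedFDeriv_comp hf h₁ hj', iteratedFDeriv_comp (h0 ▸ hf) h₂ hj']
  simp only [FormalMultilinearSeries.taylorComp, sum_apply,
    FormalMultilinearSeries.compAlongOrderedFinpartition]
  refine Finset.sum_congr rfl fun p _ => ?_
  have : (fun m => ftaylorSeries ℝ c₁ t (p.partSize m)) =
      fun m => ftaylorSeries ℝ c₂ t (p.partSize m) := by
    funext m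
    exact key _ ((p.partSize_le m).trans hj)
  rw [h0, this]

/-- Higher derivatives in time depend smoothly on parameters. -/
theorem contDiffOn_iteratedDeriv_param {X Y : Type*} [NormedAddCommGroup X] [NormedSpace ℝ X]
    [NormedAddCommGroup Y] [NormedSpace ℝ Y] {G : X → ℝ → Y} {U : Set (X × ℝ)} (hU : IsOpen U)
    (hG : ContDiffOn ℝ ∞ (fun p : X × ℝ => G p.1 p.2) U) (j : ℕ) :
    ContDiffOn ℝ ∞ (fun p : X × ℝ => iteratedDeriv j (G p.1) p.2) U := by
  induction j with
  | zero => simpa using hG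
  | succ j ih =>
    have h1 : ContDiffOn ℝ ∞
        (fderiv ℝ (fun p : X × ℝ => iteratedDeriv j (G p.1) p.2)) U :=
      ih.fderiv_of_isOpen hU (by simp)
    have h2 : ContDiffOn ℝ ∞ (fun p : X × ℝ =>
        fderiv ℝ (fun p : X × ℝ => iteratedDeriv j (G p.1) p.2) p ((0 : X), (1 : ℝ))) U :=
      h1.clm_apply contDiffOn_const
    refine h2.congr ?_
    rintro ⟨x, t⟩ hp
    have hd : DifferentiableAt ℝ (fun p : X × ℝ => iteratedDeriv j (G p.1) p.2) (x, t) :=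
      ((ih.contDiffAt (hU.mem_nhds hp)).differentiableAt (by simp))
    have hc : HasDerivAt (fun s : ℝ => (x, s)) ((0 : X), (1 : ℝ)) t :=
      (hasDerivAt_const t x).prodMk (hasDerivAt_id t)
    have := hd.hasFDerivAt.comp_hasDerivAt t hc
    simp only [iteratedDeriv_succ]
    exact this.deriv

/-! ### Higher-order tangent bundles -/

/-- The polynomial curve `t ↦ ∑ⱼ (tʲ / j!) cⱼ`. -/
def polyCurve {E : Type*} [NormedAddCommGroup E] [NormedSpace ℝ E] {k : ℕ}
    (c : Fin (k + 1) → E) (t : ℝ) : E :=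
  ∑ j : Fin (k + 1), (t ^ (j : ℕ) / (Nat.factorial j : ℝ)) • c j

theorem contDiff_polyCurve {E : Type*} [NormedAddCommGroup E] [NormedSpace ℝ E] {k : ℕ} :
    ContDiff ℝ ∞ (fun p : (Fin (k + 1) → E) × ℝ => polyCurve p.1 p.2) := by
  unfold polyCurve
  fun_prop

theorem iteratedDeriv_polyCurve {E : Type*} [NormedAddCommGroup E] [NormedSpace ℝ E] {k : ℕ}
    (c : Fin (k + 1) → E) (i : Fin (k + 1)) : iteratedDeriv i (polyCurve c) 0 = c i := by
  have : polyCurve c = fun t => ∑ j : Fin (k + 1),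
      (fun s : ℝ => (s ^ (j : ℕ) / (Nat.factorial j : ℝ)) • c j) t := rfl
  rw [this, iteratedDeriv_fun_sum (fun j _ => by fun_prop)]
  have hj : ∀ j : Fin (k + 1),
      iteratedDeriv i (fun s : ℝ => (s ^ (j : ℕ) / (Nat.factorial j : ℝ)) • c j) 0
        = if j = i then c i else 0 := by
    intro j
    have e1 : (fun s : ℝ => (s ^ (j : ℕ) / (Nat.factorial j : ℝ)) • c j) =
        fun s : ℝ => s ^ (j : ℕ) • ((Nat.factorial j : ℝ)⁻¹ • c j) := by
      funext s
      rw [smul_smul, div_eq_mul_inv]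
    rw [e1, iteratedDeriv_smul_const (f := fun s : ℝ => s ^ (j : ℕ)) (by fun_prop),
      iteratedDeriv_pow]
    rcases lt_trichotomy (j : ℕ) (i : ℕ) with h | h | h
    · have hne : j ≠ i := fun h' => by simp [h'] at h
      simp [Nat.descFactorial_eq_zero_iff_lt.mpr h, hne]
    · have he : j = i := Fin.ext h
      subst he
      have : (Nat.factorial j : ℝ) ≠ 0 := by positivity
      simp [Nat.descFactorial_self, smul_smul, this]
    · have hne : j ≠ i := fun h' => by simp [h'] at h
      have : (j : ℕ) - i ≠ 0 := by omega
      simp [this, hne]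
  simp [hj]

section Jets

variable (E : Type*) [NormedAddCommGroup E] [NormedSpace ℝ E]
  {Q : Type*} [TopologicalSpace Q] [ChartedSpace E Q]

/-- The curve `γ` in `Q` is smooth on a neighbourhood of the time `t`. -/
def SmoothNear (γ : ℝ → Q) (t : ℝ) : Prop :=
  ∀ᶠ s in 𝓝 t, ContMDiffAt 𝓘(ℝ, ℝ) 𝓘(ℝ, E) ∞ γ s

variable {E}

theorem SmoothNear.shift {γ : ℝ → Q} {t : ℝ} (h : SmoothNear E γ t) :
    SmoothNear E (fun s => γ (t + s)) 0 := by
  have hc : Tendsto (fun s : ℝ => t + s) (𝓝 0) (𝓝 t) := by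
    have : Continuous (fun s : ℝ => t + s) := by fun_prop
    simpa using this.tendsto 0
  filter_upwards [hc.eventually h] with s hs
  have h2 : ContMDiffAt 𝓘(ℝ, ℝ) 𝓘(ℝ, ℝ) ∞ (fun s : ℝ => t + s) s :=
    (by fun_prop : ContDiff ℝ ∞ (fun s : ℝ => t + s)).contMDiff.contMDiffAt
  exact ContMDiffAt.comp s hs h2

theorem smoothNear_const (q : Q) (t : ℝ) : SmoothNear E (fun _ => q) t :=
  Eventually.of_forall fun _ => contMDiffAt_const

theorem SmoothNear.eventually_mem {γ : ℝ → Q} {t : ℝ} (h : SmoothNear E γ t)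
    {e : OpenPartialHomeomorph Q E} (ht : γ t ∈ e.source) : ∀ᶠ s in 𝓝 t, γ s ∈ e.source :=
  (h.self_of_nhds.continuousAt).eventually (e.open_source.mem_nhds ht)

variable [IsManifold 𝓘(ℝ, E) ∞ Q]

theorem SmoothNear.contDiffAt {γ : ℝ → Q} {t : ℝ} (h : SmoothNear E γ t)
    {e : OpenPartialHomeomorph Q E} (he : e ∈ atlas E Q) (ht : γ t ∈ e.source) :
    ∀ᶠ s in 𝓝 t, ContDiffAt ℝ ∞ (e ∘ γ) s := by
  filter_upwards [h, h.eventually_mem ht] with s hs hs'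
  have h1 : ContMDiffAt 𝓘(ℝ, E) 𝓘(ℝ, E) ∞ e (γ s) :=
    contMDiffAt_of_mem_maximalAtlas (IsManifold.subset_maximalAtlas he) hs'
  exact (ContMDiffAt.comp s h1 hs).contDiffAt

theorem contDiffOn_transition {e e' : OpenPartialHomeomorph Q E} (he : e ∈ atlas E Q)
    (he' : e' ∈ atlas E Q) : ContDiffOn ℝ ∞ (e' ∘ e.symm) (e.symm ≫ₕ e').source := by
  have h := (contDiffGroupoid ∞ 𝓘(ℝ, E)).compatible he he'
  rw [contDiffGroupoid, mem_groupoid_of_pregroupoid] at h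
  simpa [contDiffPregroupoid] using h.1

theorem contDiffAt_transition {e e' : OpenPartialHomeomorph Q E} (he : e ∈ atlas E Q)
    (he' : e' ∈ atlas E Q) {q : Q} (hq : q ∈ e.source) (hq' : q ∈ e'.source) :
    ContDiffAt ℝ ∞ (e' ∘ e.symm) (e q) :=
  (contDiffOn_transition he he').contDiffAt
    ((e.symm ≫ₕ e').open_source.mem_nhds (by simp [hq, hq']))

variable (E) in
/-- Two curves have contact of order `k` at time `0`: they take the same value there, and in some
chart their derivatives up to order `k` agree. -/
def Contact (k : ℕ) (γ₁ γ₂ : ℝ → Q) : Prop :=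
  γ₁ 0 = γ₂ 0 ∧ ∃ e ∈ atlas E Q, γ₁ 0 ∈ e.source ∧
    ∀ j ≤ k, iteratedDeriv j (e ∘ γ₁) 0 = iteratedDeriv j (e ∘ γ₂) 0

/-- Contact may be tested in any chart. -/
theorem Contact.forall_chart {k : ℕ} {γ₁ γ₂ : ℝ → Q} (h : Contact E k γ₁ γ₂)
    (h₁ : SmoothNear E γ₁ 0) (h₂ : SmoothNear E γ₂ 0)
    {e' : OpenPartialHomeomorph Q E} (he' : e' ∈ atlas E Q) (hm : γ₁ 0 ∈ e'.source) :
    ∀ j ≤ k, iteratedDeriv j (e' ∘ γ₁) 0 = iteratedDeriv j (e' ∘ γ₂) 0 := by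
  obtain ⟨h0, e, he, hme, hj⟩ := h
  have hf : ContDiffAt ℝ ∞ (e' ∘ e.symm) ((e ∘ γ₁) 0) := contDiffAt_transition he he' hme hm
  have key := iteratedDeriv_comp_congr (h₁.contDiffAt he hme).self_of_nhds
    (h₂.contDiffAt he (h0 ▸ hme)).self_of_nhds hf hj
  have hev : ∀ {γ : ℝ → Q}, SmoothNear E γ 0 → γ 0 ∈ e.source →
      ((e' ∘ e.symm) ∘ (e ∘ γ)) =ᶠ[𝓝 0] e' ∘ γ := by
    intro γ hγ hγ0
    filter_upwards [hγ.eventually_mem hγ0] with s hs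
    simp [e.left_inv hs]
  intro j hjk
  rw [← (hev h₁ hme).iteratedDeriv_eq, ← (hev h₂ (h0 ▸ hme)).iteratedDeriv_eq]
  exact key j hjk

variable (E Q) in
/-- Smooth curves in `Q` defined near the time `0`. -/
abbrev CurveAtZero : Type _ := {γ : ℝ → Q // SmoothNear E γ 0}

variable (E Q) in
/-- Contact of order `k` as an equivalence relation on smooth curves. -/
abbrev contactSetoid (k : ℕ) : Setoid (CurveAtZero E Q) where
  r γ₁ γ₂ := Contact E k γ₁.1 γ₂.1
  iseqv :=
    { refl := fun γ => ⟨rfl, chartAt E (γ.1 0), chart_mem_atlas _ _, mem_chart_source _ _,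
        fun _ _ => rfl⟩
      symm := fun {γ₁ γ₂} h => ⟨h.1.symm, by
        obtain ⟨h0, e, he, hme, hj⟩ := h
        exact ⟨e, he, h0 ▸ hme, fun j hjk => (hj j hjk).symm⟩⟩
      trans := fun {γ₁ γ₂ γ₃} h h' => ⟨h.1.trans h'.1, by
        obtain ⟨h0, e, he, hme, hj⟩ := h
        exact ⟨e, he, hme, fun j hjk => (hj j hjk).trans
          (h'.forall_chart γ₂.2 γ₃.2 he (h0 ▸ hme) j hjk)⟩⟩ }

variable (E Q) in
/-- The tangent bundle `T^{(k)}Q` of order `k` of the manifold `Q` modelled on `E`: smooth curves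
near the time `0` up to contact of order `k`. -/
def HOTangent (k : ℕ) : Type _ := Quotient (contactSetoid E Q k)

namespace HOTangent

variable {k : ℕ}

/-- The class `[γ]₀^{(k)}`. -/
def mk (k : ℕ) (γ : CurveAtZero E Q) : HOTangent E Q k := Quotient.mk (contactSetoid E Q k) γ

/-- A curve that represents the given class. -/
def rep (x : HOTangent E Q k) : CurveAtZero E Q := Quotient.out (s := contactSetoid E Q k) x

@[simp] theorem mk_rep (x : HOTangent E Q k) : mk k x.rep = x :=
  Quotient.out_eq (s := contactSetoid E Q k) x

theorem mk_eq_iff {γ₁ γ₂ : CurveAtZero E Q} : mk k γ₁ = mk k γ₂ ↔ Contact E k γ₁.1 γ₂.1 :=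
  Quotient.eq (r := contactSetoid E Q k)

/-- The projection `T^{(k)}Q → Q`. -/
def proj (x : HOTangent E Q k) : Q := x.rep.1 0

theorem contact_rep (γ : CurveAtZero E Q) : Contact E k (mk k γ).rep.1 γ.1 :=
  mk_eq_iff.1 (mk_rep _)

@[simp] theorem proj_mk (γ : CurveAtZero E Q) : (mk k γ).proj = γ.1 0 := (contact_rep γ).1

/-- The `k`-lift `γ^{(k)}(t) = [s ↦ γ (t + s)]₀^{(k)}` of a curve `γ` in `Q` (with the class of a
constant curve as default value at times near which `γ` is not smooth). -/
def lift (k : ℕ) (γ : ℝ → Q) (t : ℝ) : HOTangent E Q k := by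
  classical
  exact if h : SmoothNear E γ t then mk k ⟨fun s => γ (t + s), h.shift⟩
    else mk k ⟨fun _ => γ t, smoothNear_const _ _⟩

@[simp] theorem proj_lift (γ : ℝ → Q) (t : ℝ) : (lift (E := E) k γ t).proj = γ t := by
  unfold lift
  split_ifs <;> simp

/-- The natural coordinates `(q_{(0)}, …, q_{(k)})` on `T^{(k)}Q` induced by a chart `e`. -/
def coord (e : OpenPartialHomeomorph Q E) (x : HOTangent E Q k) : Fin (k + 1) → E :=
  fun j => iteratedDeriv j (e ∘ x.rep.1) 0

theorem coord_mk {e : OpenPartialHomeomorph Q E} (he : e ∈ atlas E Q) (γ : CurveAtZero E Q)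
    (h : γ.1 0 ∈ e.source) :
    coord e (mk k γ) = fun j : Fin (k + 1) => iteratedDeriv j (e ∘ γ.1) 0 := by
  funext j
  exact (contact_rep γ).forall_chart (mk k γ).rep.2 γ.2 he ((contact_rep (k := k) γ).1 ▸ h) j
    (Nat.lt_succ_iff.1 j.2)

theorem coord_lift {e : OpenPartialHomeomorph Q E} (he : e ∈ atlas E Q) {γ : ℝ → Q} {t : ℝ}
    (hγ : SmoothNear E γ t) (h : γ t ∈ e.source) :
    coord e (lift k γ t) = fun j : Fin (k + 1) => iteratedDeriv j (e ∘ γ) t := by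
  unfold lift
  rw [dif_pos hγ, coord_mk he _ (by simpa using h)]
  funext j
  have := iteratedDeriv_comp_const_add (j : ℕ) (e ∘ γ) t
  have h2 := congrFun this 0
  simpa [Function.comp_def] using h2

theorem smoothNear_symm_polyCurve {e : OpenPartialHomeomorph Q E} (he : e ∈ atlas E Q)
    (c : Fin (k + 1) → E) {t : ℝ} (hc : polyCurve c t ∈ e.target) :
    SmoothNear E (fun s => e.symm (polyCurve c s)) t := by
  have hp : ContDiff ℝ ∞ (polyCurve c) := by unfold polyCurve; fun_prop
  filter_upwards [hp.continuous.continuousAt.eventually (e.open_target.mem_nhds hc)] with s hs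
  exact ContMDiffAt.comp s
    (contMDiffAt_symm_of_mem_maximalAtlas (IsManifold.subset_maximalAtlas he) hs)
    hp.contMDiff.contMDiffAt

@[simp] theorem polyCurve_zero (c : Fin (k + 1) → E) : polyCurve c 0 = c 0 := by
  simpa using iteratedDeriv_polyCurve c 0

theorem coord_zero (e : OpenPartialHomeomorph Q E) (x : HOTangent E Q k) :
    coord e x 0 = e x.proj := by
  simp [coord, proj]

/-- The natural chart of `T^{(k)}Q` induced by a chart of `Q`, as a partial bijection. -/
def chartEquiv (k : ℕ) (e : OpenPartialHomeomorph Q E) (he : e ∈ atlas E Q) :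
    PartialEquiv (HOTangent E Q k) (Fin (k + 1) → E) where
  toFun := coord e
  invFun c := lift k (fun t => e.symm (polyCurve c t)) 0
  source := {x | x.proj ∈ e.source}
  target := {c | c 0 ∈ e.target}
  map_source' x hx := by
    simpa [coord_zero] using e.map_source hx
  map_target' c hc := by
    simpa using e.map_target hc
  left_inv' x hx := by
    have hx' : x.proj ∈ e.source := hx
    have h0 : polyCurve (coord e x) 0 ∈ e.target := by
      simpa [coord_zero] using e.map_source hx'
    have hs := smoothNear_symm_polyCurve he (coord e x) h0
    conv_rhs => rw [← mk_rep x]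
    unfold lift
    rw [dif_pos hs, mk_eq_iff]
    have hb : e.symm (polyCurve (coord e x) 0) = x.proj := by
      simp [coord_zero, e.left_inv hx']
    refine ⟨by simpa [proj] using hb, e, he, by simpa [coord_zero, e.left_inv hx'] using hx', ?_⟩
    intro j hj
    have hp : Continuous (polyCurve (coord e x)) := by unfold polyCurve; fun_prop
    have hev : (e ∘ fun s => e.symm (polyCurve (coord e x) (0 + s))) =ᶠ[𝓝 0]
        polyCurve (coord e x) := by
      filter_upwards [hp.continuousAt.eventually (e.open_target.mem_nhds h0)] with s hs
      simpa using e.right_inv hs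
    rw [hev.iteratedDeriv_eq]
    exact iteratedDeriv_polyCurve (coord e x) ⟨j, Nat.lt_succ_of_le hj⟩
  right_inv' c hc := by
    have hc' : c 0 ∈ e.target := hc
    have h0 : polyCurve c 0 ∈ e.target := by simpa using hc'
    rw [coord_lift he (smoothNear_symm_polyCurve he c h0) (e.map_target h0)]
    funext j
    have hp : Continuous (polyCurve c) := by unfold polyCurve; fun_prop
    have hev : (e ∘ fun s => e.symm (polyCurve c s)) =ᶠ[𝓝 0] polyCurve c := by
      filter_upwards [hp.continuousAt.eventually (e.open_target.mem_nhds h0)] with s hs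
      simpa using e.right_inv hs
    rw [hev.iteratedDeriv_eq]
    exact iteratedDeriv_polyCurve c j

theorem isOpen_chartEquiv_source {e e' : OpenPartialHomeomorph Q E} (he : e ∈ atlas E Q)
    (he' : e' ∈ atlas E Q) :
    IsOpen ((chartEquiv k e he).symm.trans (chartEquiv k e' he')).source := by
  have : ((chartEquiv k e he).symm.trans (chartEquiv k e' he')).source =
      (fun c : Fin (k + 1) → E => c 0) ⁻¹' (e.symm ≫ₕ e').source := by
    ext c
    simp [chartEquiv, PartialEquiv.trans_source]
  rw [this]
  exact (e.symm ≫ₕ e').open_source.preimage (continuous_apply 0)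

/-- The changes of natural coordinates are smooth. -/
theorem contDiffOn_chartEquiv {e e' : OpenPartialHomeomorph Q E} (he : e ∈ atlas E Q)
    (he' : e' ∈ atlas E Q) :
    ContDiffOn ℝ ∞ ((chartEquiv k e he).symm.trans (chartEquiv k e' he'))
      ((chartEquiv k e he).symm.trans (chartEquiv k e' he')).source := by
  set U : Set ((Fin (k + 1) → E) × ℝ) :=
    (fun p => polyCurve p.1 p.2) ⁻¹' (e.symm ≫ₕ e').source
  have hU : IsOpen U := (e.symm ≫ₕ e').open_source.preimage contDiff_polyCurve.continuous
  have hG : ContDiffOn ℝ ∞ (fun p : (Fin (k + 1) → E) × ℝ =>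
      ((fun (c : Fin (k + 1) → E) (t : ℝ) => (e' ∘ e.symm) (polyCurve c t)) p.1 p.2)) U :=
    (contDiffOn_transition he he').comp contDiff_polyCurve.contDiffOn (fun _ h => h)
  rw [contDiffOn_pi]
  intro j
  have h1 := contDiffOn_iteratedDeriv_param
    (G := fun (c : Fin (k + 1) → E) (t : ℝ) => (e' ∘ e.symm) (polyCurve c t)) hU hG j
  have h2 : ContDiffOn ℝ ∞ (fun c : Fin (k + 1) → E =>
      iteratedDeriv j (fun t => (e' ∘ e.symm) (polyCurve c t)) 0)
      ((chartEquiv k e he).symm.trans (chartEquiv k e' he')).source := by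
    refine h1.comp (f := fun c : Fin (k + 1) → E => (c, (0 : ℝ))) (by fun_prop) ?_
    intro c hc
    simpa [U, chartEquiv, PartialEquiv.trans_source] using hc
  refine h2.congr ?_
  intro c hc
  have hc' : c 0 ∈ e.target ∧ e.symm (c 0) ∈ e'.source := by
    simpa [chartEquiv, PartialEquiv.trans_source] using hc
  have h0 : polyCurve c 0 ∈ e.target := by simpa using hc'.1
  have := coord_lift (k := k) he' (smoothNear_symm_polyCurve he c h0) (by simpa using hc'.2)
  exact congrFun this j

variable (E Q) in
/-- The natural charts, as data that determine a topology and an atlas. -/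
def chartedSpaceCore (k : ℕ) : ChartedSpaceCore (Fin (k + 1) → E) (HOTangent E Q k) where
  atlas := {f | ∃ (e : OpenPartialHomeomorph Q E) (he : e ∈ atlas E Q), f = chartEquiv k e he}
  chartAt x := chartEquiv k (chartAt E x.proj) (chart_mem_atlas E x.proj)
  mem_chart_source x := mem_chart_source E x.proj
  chart_mem_atlas x := ⟨_, _, rfl⟩
  open_source := by
    rintro _ _ ⟨e, he, rfl⟩ ⟨e', he', rfl⟩
    exact isOpen_chartEquiv_source he he'
  continuousOn_toFun := by
    rintro _ _ ⟨e, he, rfl⟩ ⟨e', he', rfl⟩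
    exact (contDiffOn_chartEquiv he he').continuousOn

instance : TopologicalSpace (HOTangent E Q k) := (chartedSpaceCore E Q k).toTopologicalSpace

instance : ChartedSpace (Fin (k + 1) → E) (HOTangent E Q k) :=
  (chartedSpaceCore E Q k).toChartedSpace

/-- The natural chart of `T^{(k)}Q` induced by a chart of `Q`. -/
def natChart (k : ℕ) (e : OpenPartialHomeomorph Q E) (he : e ∈ atlas E Q) :
    OpenPartialHomeomorph (HOTangent E Q k) (Fin (k + 1) → E) :=
  (chartedSpaceCore E Q k).openPartialHomeomorph (chartEquiv k e he) ⟨e, he, rfl⟩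

theorem mem_atlas_iff {f : OpenPartialHomeomorph (HOTangent E Q k) (Fin (k + 1) → E)} :
    f ∈ atlas (Fin (k + 1) → E) (HOTangent E Q k) ↔
      ∃ (e : OpenPartialHomeomorph Q E) (he : e ∈ atlas E Q), f = natChart k e he := by
  constructor
  · intro h
    obtain ⟨_, ⟨e, he, rfl⟩, h⟩ := mem_iUnion₂.1 h
    exact ⟨e, he, h⟩
  · rintro ⟨e, he, rfl⟩
    exact mem_iUnion₂.2 ⟨_, ⟨e, he, rfl⟩, rfl⟩

instance : IsManifold 𝓘(ℝ, Fin (k + 1) → E) ∞ (HOTangent E Q k) := by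
  refine isManifold_of_contDiffOn _ _ _ ?_
  intro f f' hf hf'
  obtain ⟨e, he, rfl⟩ := mem_atlas_iff.1 hf
  obtain ⟨e', he', rfl⟩ := mem_atlas_iff.1 hf'
  have h := contDiffOn_chartEquiv (k := k) he he'
  simp only [PartialEquiv.coe_trans, PartialEquiv.trans_source] at h
  simp only [modelWithCornersSelf_coe, modelWithCornersSelf_coe_symm, range_id, inter_univ,
    preimage_id_eq, id_eq, Function.id_comp, Function.comp_id]
  exact h

end HOTangent

/-- The velocity `d/dt σ(t)` of a curve `σ` in a manifold, as a point of the tangent bundle. -/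
def velocity {F H : Type*} [NormedAddCommGroup F] [NormedSpace ℝ F] [TopologicalSpace H]
    (J : ModelWithCorners ℝ F H) {M : Type*} [TopologicalSpace M] [ChartedSpace H M]
    (σ : ℝ → M) (t : ℝ) : TangentBundle J M :=
  ⟨σ t, mfderiv 𝓘(ℝ, ℝ) J σ t (1 : ℝ)⟩

namespace HOTangent

variable {k : ℕ}

/-- In natural coordinates, the lift of a curve consists of its derivatives. -/
theorem lift_eventuallyEq {e : OpenPartialHomeomorph Q E} (he : e ∈ atlas E Q) {γ : ℝ → Q} {t : ℝ}
    (hγ : SmoothNear E γ t) (h : γ t ∈ e.source) :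
    lift (E := E) k γ =ᶠ[𝓝 t] (natChart k e he).symm ∘
      fun s => fun j : Fin (k + 1) => iteratedDeriv j (e ∘ γ) s := by
  filter_upwards [hγ.eventually_mem h, eventually_eventually_nhds.2 hγ] with s hs hs'
  have h1 : lift k γ s ∈ (natChart k e he).source := by
    change (lift k γ s).proj ∈ e.source
    simpa using hs
  have h2 : natChart k e he (lift k γ s) = fun j : Fin (k + 1) => iteratedDeriv j (e ∘ γ) s :=
    coord_lift he hs' hs
  simp [← h2, (natChart k e he).left_inv h1]

/-- The velocity of the `k`-lift of a curve depends only on the class of order `k + 1`. -/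
theorem velocity_lift_congr {γ₁ γ₂ : ℝ → Q} (h₁ : SmoothNear E γ₁ 0) (h₂ : SmoothNear E γ₂ 0)
    (h : Contact E (k + 1) γ₁ γ₂) :
    velocity 𝓘(ℝ, Fin (k + 1) → E) (lift (E := E) k γ₁) 0 =
      velocity 𝓘(ℝ, Fin (k + 1) → E) (lift (E := E) k γ₂) 0 := by
  obtain ⟨h0, e, he, hm, hj⟩ := h
  have key : ∀ {γ : ℝ → Q}, SmoothNear E γ 0 → γ 0 ∈ e.source →
      velocity 𝓘(ℝ, Fin (k + 1) → E) (lift (E := E) k γ) 0 =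
        tangentMap 𝓘(ℝ, Fin (k + 1) → E) 𝓘(ℝ, Fin (k + 1) → E) (natChart k e he).symm
          ⟨fun j : Fin (k + 1) => iteratedDeriv j (e ∘ γ) 0,
            (fun j : Fin (k + 1) => iteratedDeriv (j + 1) (e ∘ γ) 0 : Fin (k + 1) → E)⟩ := by
    intro γ hγ hm
    have hev := lift_eventuallyEq (k := k) he hγ hm
    have hd : HasDerivAt (fun s => fun j : Fin (k + 1) => iteratedDeriv j (e ∘ γ) s)
        (fun j : Fin (k + 1) => iteratedDeriv (j + 1) (e ∘ γ) 0) 0 := by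
      rw [hasDerivAt_pi]
      intro j
      have hdj : DifferentiableAt ℝ (iteratedDeriv j (e ∘ γ)) 0 := by
        have h1 := (hγ.contDiffAt he hm).self_of_nhds.differentiableAt_iteratedFDeriv
          (m := j) (by exact_mod_cast WithTop.coe_lt_top _)
        rw [iteratedDeriv_eq_equiv_comp]
        exact (LinearIsometryEquiv.differentiable _).differentiableAt.comp _ h1
      rw [iteratedDeriv_succ]
      exact hdj.hasDerivAt
    have hmem : (fun j : Fin (k + 1) => iteratedDeriv j (e ∘ γ) 0) ∈
        (natChart k e he).target := by
      change iteratedDeriv _ (e ∘ γ) 0 ∈ e.target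
      simpa using e.map_source hm
    have hsymm : MDifferentiableAt 𝓘(ℝ, Fin (k + 1) → E) 𝓘(ℝ, Fin (k + 1) → E)
        (natChart k e he).symm (fun j : Fin (k + 1) => iteratedDeriv j (e ∘ γ) 0) :=
      (contMDiffAt_symm_of_mem_maximalAtlas (IsManifold.subset_maximalAtlas
        (mem_atlas_iff.2 ⟨e, he, rfl⟩)) hmem : ContMDiffAt _ _ ∞ _ _).mdifferentiableAt (by simp)
    have hm := hsymm.hasMFDerivAt.comp (0 : ℝ) hd.hasFDerivAt.hasMFDerivAt
    have hm' := hm.congr_of_eventuallyEq hev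
    unfold velocity tangentMap
    rw [hm'.mfderiv]
    have hb : lift k γ 0 = (natChart k e he).symm
        fun j : Fin (k + 1) => iteratedDeriv j (e ∘ γ) 0 := hev.self_of_nhds
    have hmk : ∀ (x y : HOTangent E Q k) (v : Fin (k + 1) → E), x = y →
        (⟨x, v⟩ : TangentBundle 𝓘(ℝ, Fin (k + 1) → E) (HOTangent E Q k)) = ⟨y, v⟩ := by
      rintro x _ v rfl
      rfl
    refine (hmk _ _ _ hb).trans ?_
    congr 1
    exact congrArg _ (one_smul ℝ _)
  rw [key h₁ hm, key h₂ (h0 ▸ hm)]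
  have e1 : (fun j : Fin (k + 1) => iteratedDeriv j (e ∘ γ₁) 0) =
      fun j : Fin (k + 1) => iteratedDeriv j (e ∘ γ₂) 0 :=
    funext fun j => hj j (by omega)
  have e2 : (fun j : Fin (k + 1) => iteratedDeriv (j + 1) (e ∘ γ₁) 0) =
      fun j : Fin (k + 1) => iteratedDeriv (j + 1) (e ∘ γ₂) 0 :=
    funext fun j => hj (j + 1) (by omega)
  rw [e1, e2]

/-- The canonical immersion `T^{(k+1)}Q → T(T^{(k)}Q)`, which sends the class of `γ` to the
velocity at time `0` of the `k`-lift of `γ`. -/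
def canonicalImmersion (x : HOTangent E Q (k + 1)) :
    TangentBundle 𝓘(ℝ, Fin (k + 1) → E) (HOTangent E Q k) :=
  Quotient.lift (s := contactSetoid E Q (k + 1))
    (fun γ : CurveAtZero E Q => velocity 𝓘(ℝ, Fin (k + 1) → E) (lift (E := E) k γ.1) 0)
    (fun γ₁ γ₂ h => velocity_lift_congr γ₁.2 γ₂.2 h) x

end HOTangent

end Jets

/-! ### The Tulczyjew isomorphism -/

section Tulczyjew

variable {F H : Type*} [NormedAddCommGroup F] [NormedSpace ℝ F] [TopologicalSpace H]

/-- The cotangent bundle of a manifold. -/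
abbrev CotangentBundle (J : ModelWithCorners ℝ F H) (M : Type*) [TopologicalSpace M]
    [ChartedSpace H M] : Type _ :=
  TotalSpace (F →L[ℝ] ℝ) (fun x : M => TangentSpace J x →L[ℝ] ℝ)

/-- The model of the cotangent bundle of a manifold with model `J`. -/
abbrev cotangentModel (J : ModelWithCorners ℝ F H) :
    ModelWithCorners ℝ (F × (F →L[ℝ] ℝ)) (ModelProd H (F →L[ℝ] ℝ)) :=
  J.prod 𝓘(ℝ, F →L[ℝ] ℝ)

/-- The velocity of a curve is the derivative of the curve in the preferred chart. -/
theorem hasDerivAt_chart {J : ModelWithCorners ℝ F H} {M : Type*} [TopologicalSpace M]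
    [ChartedSpace H M] {f : ℝ → M} {t : ℝ} (hf : MDifferentiableAt 𝓘(ℝ, ℝ) J f t) :
    HasDerivAt (fun s => extChartAt J (f t) (f s)) (mfderiv 𝓘(ℝ, ℝ) J f t (1 : ℝ) : F) t := by
  obtain ⟨D, hD⟩ : ∃ D : ℝ →L[ℝ] F, D = mfderiv 𝓘(ℝ, ℝ) J f t := ⟨_, rfl⟩
  have h := hf.hasMFDerivAt.2
  rw [← hD] at h ⊢
  simp only [writtenInExtChartAt, Function.comp_def, mfld_simps] at h
  have h' : HasFDerivAt (fun s => extChartAt J (f t) (f s)) D t := by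
    have h2 := hasFDerivWithinAt_univ.1 h
    simp only [extChartAt, OpenPartialHomeomorph.extend, PartialEquiv.coe_trans,
      Function.comp_def] at h2 ⊢
    exact h2
  exact h'.hasDerivAt

variable {J : ModelWithCorners ℝ F H} {M : Type*} [TopologicalSpace M] [ChartedSpace H M]
  [IsManifold J ∞ M]

/-- The Tulczyjew isomorphism `α_M : TT*M → T*TM`, which in natural coordinates reads
`(q, p, q̇, ṗ) ↦ (q, q̇, ṗ, p)`. The components `q̇`, `ṗ` of a tangent vector `V` at the point
`(x, p)` of `T*M`, and those of a covector at the point `(x, q̇)` of `TM`, are the ones in the natural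
coordinates that the preferred chart at `x` induces on `T*M` and on `TM`. -/
def tulczyjewAlpha (V : TangentBundle (cotangentModel J) (CotangentBundle J M)) :
    CotangentBundle J.tangent (TangentBundle J M) :=
  let x : M := V.proj.proj
  let p : F →L[ℝ] ℝ := V.proj.snd
  let dq : F := Prod.fst (α := F) (β := F →L[ℝ] ℝ) V.snd
  let dp : F →L[ℝ] ℝ := Prod.snd (α := F) (β := F →L[ℝ] ℝ) V.snd
  ⟨(⟨x, dq⟩ : TangentBundle J M), (dp.coprod p : F × F →L[ℝ] ℝ)⟩

/-- The canonical flip `κ_M : TTM → TTM`, which in natural coordinates reads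
`(q, v, q̇, v̇) ↦ (q, q̇, v, v̇)`. -/
def canonicalFlip (W : TangentBundle J.tangent (TangentBundle J M)) :
    TangentBundle J.tangent (TangentBundle J M) :=
  let x : M := W.proj.proj
  let v : F := W.proj.snd
  let dq : F := Prod.fst (α := F) (β := F) W.snd
  let dv : F := Prod.snd (α := F) (β := F) W.snd
  ⟨(⟨x, dq⟩ : TangentBundle J M), ((v, dv) : F × F)⟩

/-- The Tulczyjew isomorphism is the dual of the canonical flip: for covectors `p s` and vectors
`v s` along the same curve, with velocities `V` in `TT*M` and `W` in `TTM`, the covector `α_M(V)` and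
the vector `κ_M(W)` sit at the same point of `TM`, and `d/dt ⟨p, v⟩ = ⟨α_M(V), κ_M(W)⟩`. -/
theorem hasDerivAt_pairing {x : ℝ → M} (p : ∀ t, TangentSpace J (x t) →L[ℝ] ℝ)
    (v : ∀ t, TangentSpace J (x t)) {t : ℝ}
    (hp : MDifferentiableAt 𝓘(ℝ, ℝ) (cotangentModel J)
      (fun s => (⟨x s, p s⟩ : CotangentBundle J M)) t)
    (hv : MDifferentiableAt 𝓘(ℝ, ℝ) J.tangent (fun s => (⟨x s, v s⟩ : TangentBundle J M)) t) :
    (tulczyjewAlpha (velocity (cotangentModel J)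
      (fun s => (⟨x s, p s⟩ : CotangentBundle J M)) t)).proj =
    (canonicalFlip (velocity J.tangent (fun s => (⟨x s, v s⟩ : TangentBundle J M)) t)).proj ∧
    HasDerivAt (fun s => p s (v s))
      ((tulczyjewAlpha (velocity (cotangentModel J)
          (fun s => (⟨x s, p s⟩ : CotangentBundle J M)) t)).snd
        ((canonicalFlip (velocity J.tangent
          (fun s => (⟨x s, v s⟩ : TangentBundle J M)) t)).snd : F × F)) t := by
  have hp' := hasDerivAt_chart hp
  have hv' := hasDerivAt_chart hv
  set dp : F × (F →L[ℝ] ℝ) := mfderiv 𝓘(ℝ, ℝ) (cotangentModel J)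
      (fun s => (⟨x s, p s⟩ : CotangentBundle J M)) t (1 : ℝ) with hdp
  set dv : F × F := mfderiv 𝓘(ℝ, ℝ) J.tangent
      (fun s => (⟨x s, v s⟩ : TangentBundle J M)) t (1 : ℝ) with hdv
  have hx : ContinuousAt x t := (FiberBundle.continuous_proj F (TangentSpace J : M → Type _)).continuousAt.comp
    hv.continuousAt
  have p1 : HasDerivAt (fun s => extChartAt J (x t) (x s)) dp.1 t := by
    have := (ContinuousLinearMap.fst ℝ F (F →L[ℝ] ℝ)).hasFDerivAt.comp_hasDerivAt t hp'
    rw [FiberBundle.extChartAt] at this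
    simpa [hom_trivializationAt_apply, Function.comp_def] using this
  have p2 : HasDerivAt (fun s => ContinuousLinearMap.inCoordinates F (TangentSpace J) ℝ
      (fun _ : M => ℝ) (x t) (x s) (x t) (x s) (p s)) dp.2 t := by
    have := (ContinuousLinearMap.snd ℝ F (F →L[ℝ] ℝ)).hasFDerivAt.comp_hasDerivAt t hp'
    rw [FiberBundle.extChartAt] at this
    simpa [hom_trivializationAt_apply, Function.comp_def] using this
  have v1 : HasDerivAt (fun s => extChartAt J (x t) (x s)) dv.1 t := by
    have := (ContinuousLinearMap.fst ℝ F F).hasFDerivAt.comp_hasDerivAt t hv'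
    erw [FiberBundle.extChartAt] at this
    simpa [Function.comp_def] using this
  have v2 : HasDerivAt (fun s => (trivializationAt F (TangentSpace J) (x t)
      (⟨x s, v s⟩ : TangentBundle J M)).2) dv.2 t := by
    have := (ContinuousLinearMap.snd ℝ F F).hasFDerivAt.comp_hasDerivAt t hv'
    erw [FiberBundle.extChartAt] at this
    simpa [Function.comp_def] using this
  have hmem : ∀ᶠ s in 𝓝 t, x s ∈ (trivializationAt F (TangentSpace J) (x t)).baseSet :=
    hx.eventually ((trivializationAt F (TangentSpace J) (x t)).open_baseSet.mem_nhds
      (FiberBundle.mem_baseSet_trivializationAt' _))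
  have hcl : ∀ s, x s ∈ (trivializationAt F (TangentSpace J) (x t)).baseSet →
      (trivializationAt F (TangentSpace J) (x t) (⟨x s, v s⟩ : TangentBundle J M)).2 =
        (trivializationAt F (TangentSpace J) (x t)).continuousLinearMapAt ℝ (x s) (v s) := by
    intro s hs
    rw [Trivialization.continuousLinearMapAt_apply, Trivialization.coe_linearMapAt_of_mem _ hs]
  have key := p2.clm_apply v2
  refine ⟨?_, ?_⟩
  · have : dp.1 = dv.1 := p1.unique v1
    change (⟨x t, dp.1⟩ : TangentBundle J M) = ⟨x t, dv.1⟩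
    rw [this]
  · have hval : HasDerivAt (fun s => p s (v s)) _ t := key.congr_of_eventuallyEq (by
      filter_upwards [hmem] with s hs
      have h1 := (trivializationAt F (TangentSpace J) (x t)).symmL_continuousLinearMapAt
        (R := ℝ) hs (v s)
      rw [hcl s hs]
      simp only [ContinuousLinearMap.inCoordinates, ContinuousLinearMap.comp_apply, h1]
      simp)
    have e1 : (trivializationAt F (TangentSpace J) (x t)
        (⟨x t, v t⟩ : TangentBundle J M)).2 = v t := by
      rw [hcl t hmem.self_of_nhds, TangentBundle.continuousLinearMapAt_trivializationAt_eq_core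
        (mem_chart_source H (x t))]
      exact (tangentBundleCore J M).coordChange_self _ _ (mem_chart_source H (x t)) _
    have e2 : ContinuousLinearMap.inCoordinates F (TangentSpace J) ℝ
      (fun _ : M => ℝ) (x t) (x t) (x t) (x t) (p t) = p t := by
      ext w
      have h1 : (trivializationAt F (TangentSpace J) (x t)).symmL ℝ (x t) w = w := by
        rw [TangentBundle.symmL_trivializationAt_eq_core (mem_chart_source H (x t))]
        exact (tangentBundleCore J M).coordChange_self _ _ (mem_chart_source H (x t)) _
      simp only [ContinuousLinearMap.inCoordinates, ContinuousLinearMap.comp_apply, h1]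
      simp
      rfl
    rw [e1, e2] at hval
    exact hval

end Tulczyjew

/-! ### Higher-order Lagrangian dynamics -/

section Dynamics

variable {E : Type*} [NormedAddCommGroup E] [NormedSpace ℝ E]
  {Q : Type*} [TopologicalSpace Q] [ChartedSpace E Q] [IsManifold 𝓘(ℝ, E) ∞ Q] {k : ℕ}

/-- The submanifold `Σ_L = {μ ∈ T*TT^{(k)}Q | j* μ = dL}` generated by a Lagrangian `L` on
`T^{(k+1)}Q`, where `j : T^{(k+1)}Q → TT^{(k)}Q` is the canonical immersion. -/
def lagrangianSubmanifold (L : HOTangent E Q (k + 1) → ℝ) :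
    Set (CotangentBundle 𝓘(ℝ, Fin (k + 1) → E).tangent
      (TangentBundle 𝓘(ℝ, Fin (k + 1) → E) (HOTangent E Q k))) :=
  {μ | ∃ (x : HOTangent E Q (k + 1))
      (p : TangentSpace 𝓘(ℝ, Fin (k + 1) → E).tangent x.canonicalImmersion →L[ℝ] ℝ),
    μ = ⟨x.canonicalImmersion, p⟩ ∧
      p ∘L mfderiv 𝓘(ℝ, Fin (k + 1 + 1) → E) 𝓘(ℝ, Fin (k + 1) → E).tangent
          HOTangent.canonicalImmersion x =
        mfderiv 𝓘(ℝ, Fin (k + 1 + 1) → E) 𝓘(ℝ, ℝ) L x}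

/-- The submanifold `N_L = α⁻¹(Σ_L)` of `TT*T^{(k)}Q`. -/
def dynamicsSubmanifold (L : HOTangent E Q (k + 1) → ℝ) :
    Set (TangentBundle (cotangentModel 𝓘(ℝ, Fin (k + 1) → E))
      (CotangentBundle 𝓘(ℝ, Fin (k + 1) → E) (HOTangent E Q k))) :=
  tulczyjewAlpha ⁻¹' lagrangianSubmanifold L

/-- The curve `μ` in `T*TT^{(k)}Q` is, on `I`, a solution of the Lagrangian system of order `k + 1`
described by `L`: it is smooth, and it corresponds under `α` to the velocity of a smooth curve `σ`
in `T*T^{(k)}Q` that solves the implicit differential equation `N_L`. -/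
def IsSolution (L : HOTangent E Q (k + 1) → ℝ) (I : Set ℝ)
    (μ : ℝ → CotangentBundle 𝓘(ℝ, Fin (k + 1) → E).tangent
      (TangentBundle 𝓘(ℝ, Fin (k + 1) → E) (HOTangent E Q k))) : Prop :=
  ContMDiffOn 𝓘(ℝ, ℝ) (cotangentModel 𝓘(ℝ, Fin (k + 1) → E).tangent) ∞ μ I ∧
  ∃ σ : ℝ → CotangentBundle 𝓘(ℝ, Fin (k + 1) → E) (HOTangent E Q k),
    ContMDiffOn 𝓘(ℝ, ℝ) (cotangentModel 𝓘(ℝ, Fin (k + 1) → E)) ∞ σ I ∧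
    ∀ t ∈ I, velocity (cotangentModel 𝓘(ℝ, Fin (k + 1) → E)) σ t ∈ dynamicsSubmanifold L ∧
      μ t = tulczyjewAlpha (velocity (cotangentModel 𝓘(ℝ, Fin (k + 1) → E)) σ t)

/-- The partial differential `∂L/∂q_{(j)}` of a function `L` on `T^{(k)}Q` in the natural
coordinates `(q_{(0)}, …, q_{(k)})` induced by the chart `e`, with components `∂L/∂q_{(j)}^i`. -/
def partialDiff (L : HOTangent E Q k → ℝ) (e : OpenPartialHomeomorph Q E) (he : e ∈ atlas E Q)
    (j : Fin (k + 1)) (x : HOTangent E Q k) : E →L[ℝ] ℝ :=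
  fderiv ℝ (L ∘ (HOTangent.natChart k e he).symm) (HOTangent.natChart k e he x) ∘L
    ContinuousLinearMap.single ℝ (fun _ : Fin (k + 1) => E) j

/-- The curve `γ` satisfies on `I` the Euler-Lagrange equations of order `k`
`∑ⱼ (-1)ʲ dʲ/dtʲ (∂L/∂q_{(j)}^i) = 0`, in all charts of `Q`. -/
def IsEulerLagrange (L : HOTangent E Q k → ℝ) (I : Set ℝ) (γ : ℝ → Q) : Prop :=
  ∀ t ∈ I, ∀ (e : OpenPartialHomeomorph Q E) (he : e ∈ atlas E Q), γ t ∈ e.source →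
    ∑ j : Fin (k + 1), (-1 : ℝ) ^ (j : ℕ) •
      iteratedDeriv j (fun s => partialDiff L e he j (HOTangent.lift k γ s)) t = 0

end Dynamics

end HigherOrder

end

/-! The Lagrangian has order `k + 1`, so the phase space is the cotangent bundle of T^{(k)}Q. A
chart of Q induces coordinates q_{(0)}, …, q_{(k)} on T^{(k)}Q. In these coordinates the canonical
immersion is the linear map `immersionCoord`, sending c to its truncation (c_0, …, c_k) and its
shift (c_1, …, c_{k+1}).

The velocity of σ = (q, p) lies in N_L exactly when (q, q̇) is the image of some y in T^{(k+1)}Q and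
the covector (ṗ, p), composed with `immersionCoord`, is dL at y. The first condition forces
q_{(j+1)} = dq_{(j)}/dt, so the base curve is the lift of its projection γ to Q
(`eq_lift_of_velocity_mem_range`). Let P_{n+1} be the component of p dual to q_{(n)}, and set P_0 =
P_{k+2} = 0. The second condition then reads (`velocity_mem_dynamicsSubmanifold_iff_of_lift`) P_n +
dP_{n+1}/dt = ∂L/∂q_{(n)} for 0 ≤ n ≤ k + 1. Solved downwards from P_{k+2} = 0, it gives P_m = ∑_i
(-1)^i d^i/dt^i ∂L/∂q_{(m+i)}, the Jacobi-Ostrogradsky momenta (`eventuallyEq_ostrogradsky`). So γ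
determines σ, and hence μ. The remaining requirement P_0 = 0 is the Euler–Lagrange equation.

Conversely, under the Euler–Lagrange equations these momenta define a local σ in each chart. That
the local curves agree needs no computation: N_L is intrinsic, so a curve built in one chart solves
N_L as read in any other chart, and uniqueness there gives it that chart's momenta
(`exists_solution`).

The coordinate formula for α needs proof, because `tulczyjewAlpha` uses the preferred chart at each
foot point, which changes along the curve. `tulczyjewAlpha_velocity` establishes the formula in an
arbitrary fixed chart: the second derivatives of the transition map that appear on the two sides
agree because second derivatives are symmetric. -/

noncomputable section

namespace HigherOrder

/-! ### Coordinates on tangent and cotangent bundles induced by an arbitrary chart -/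

section Coordinates

variable {F : Type*} [NormedAddCommGroup F] [NormedSpace ℝ F]
  {M : Type*} [TopologicalSpace M] [ChartedSpace F M]

/-- The derivative of a chart, on the tangent space in its preferred coordinates. -/
def chartDeriv (e : OpenPartialHomeomorph M F) (x : M) : F →L[ℝ] F :=
  mfderiv 𝓘(ℝ, F) 𝓘(ℝ, F) e x

/-- The derivative of the inverse of a chart. -/
def chartDerivSymm (e : OpenPartialHomeomorph M F) (x : M) : F →L[ℝ] F :=
  mfderiv 𝓘(ℝ, F) 𝓘(ℝ, F) e.symm (e x)

/-- The coordinates `(q, q̇)` on `TM` induced by a chart of `M`. -/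
def tangentCoord (e : OpenPartialHomeomorph M F) (z : TangentBundle 𝓘(ℝ, F) M) : F × F :=
  (e z.proj, chartDeriv e z.proj z.snd)

/-- The momenta `p` in the coordinates `(q, p)` on `T*M` induced by a chart of `M`. -/
def momentum (e : OpenPartialHomeomorph M F) (s : CotangentBundle 𝓘(ℝ, F) M) : F →L[ℝ] ℝ :=
  (show F →L[ℝ] ℝ from s.snd) ∘L chartDerivSymm e s.proj

/-- The point of `T*M` over `x` with given momenta. -/
def ofMomentum (e : OpenPartialHomeomorph M F) (x : M) (P : F →L[ℝ] ℝ) :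
    CotangentBundle 𝓘(ℝ, F) M :=
  ⟨x, (P ∘L chartDeriv e x : F →L[ℝ] ℝ)⟩

variable {e e' : OpenPartialHomeomorph M F}

theorem mdifferentiable_of_mem_maximalAtlas (he : e ∈ IsManifold.maximalAtlas 𝓘(ℝ, F) ∞ M) :
    e.MDifferentiable 𝓘(ℝ, F) 𝓘(ℝ, F) :=
  ⟨(contMDiffOn_of_mem_maximalAtlas he).mdifferentiableOn (by simp),
    (contMDiffOn_symm_of_mem_maximalAtlas he).mdifferentiableOn (by simp)⟩

theorem chartDerivSymm_chartDeriv (he : e ∈ IsManifold.maximalAtlas 𝓘(ℝ, F) ∞ M) {x : M}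
    (hx : x ∈ e.source) (v : F) :
    chartDerivSymm e x
      (chartDeriv e x v) = v :=
  congrArg (fun A : F →L[ℝ] F => A v)
    ((mdifferentiable_of_mem_maximalAtlas he).symm_comp_deriv hx)

theorem chartDeriv_chartDerivSymm (he : e ∈ IsManifold.maximalAtlas 𝓘(ℝ, F) ∞ M) {x : M}
    (hx : x ∈ e.source) (v : F) :
    chartDeriv e x
      (chartDerivSymm e x v) = v := by
  have := (mdifferentiable_of_mem_maximalAtlas he).comp_symm_deriv (e.map_source hx)
  rw [e.left_inv hx] at this
  exact congrArg (fun A : F →L[ℝ] F => A v) this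

theorem tangentCoord_inj (he : e ∈ IsManifold.maximalAtlas 𝓘(ℝ, F) ∞ M)
    {z z' : TangentBundle 𝓘(ℝ, F) M} (hz : z.proj ∈ e.source) (hz' : z'.proj ∈ e.source)
    (h : tangentCoord e z = tangentCoord e z') : z = z' := by
  obtain ⟨x, v⟩ := z
  obtain ⟨x', v'⟩ := z'
  obtain rfl : x = x' := e.injOn hz hz' (congrArg Prod.fst h)
  have h2 : chartDeriv e x v =
    chartDeriv e x v' := congrArg Prod.snd h
  have := congrArg (chartDerivSymm e x) h2
  rw [chartDerivSymm_chartDeriv he hz v, chartDerivSymm_chartDeriv he hz v'] at this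
  exact congrArg (fun w : F => (⟨x, w⟩ : TangentBundle 𝓘(ℝ, F) M)) this

theorem momentum_ofMomentum (he : e ∈ IsManifold.maximalAtlas 𝓘(ℝ, F) ∞ M) {x : M}
    (hx : x ∈ e.source) (P : F →L[ℝ] ℝ) : momentum e (ofMomentum e x P) = P := by
  ext v
  exact congrArg P (chartDeriv_chartDerivSymm he hx v)

theorem ofMomentum_momentum (he : e ∈ IsManifold.maximalAtlas 𝓘(ℝ, F) ∞ M)
    {s : CotangentBundle 𝓘(ℝ, F) M} (hs : s.proj ∈ e.source) :
    ofMomentum e s.proj (momentum e s) = s := by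
  obtain ⟨x, p⟩ := s
  refine congrArg (fun w : F →L[ℝ] ℝ => (⟨x, w⟩ : CotangentBundle 𝓘(ℝ, F) M)) ?_
  ext v
  exact congrArg (p : F →L[ℝ] ℝ) (chartDerivSymm_chartDeriv he hs v)

theorem momentum_inj (he : e ∈ IsManifold.maximalAtlas 𝓘(ℝ, F) ∞ M)
    {s s' : CotangentBundle 𝓘(ℝ, F) M} (hs : s.proj ∈ e.source) (hp : s.proj = s'.proj)
    (h : momentum e s = momentum e s') : s = s' := by
  rw [← ofMomentum_momentum (s := s) he hs, ← ofMomentum_momentum (s := s') he (hp ▸ hs), hp, h]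

theorem contDiffAt_transition_of_mem_maximalAtlas
    (he : e ∈ IsManifold.maximalAtlas 𝓘(ℝ, F) ∞ M)
    (he' : e' ∈ IsManifold.maximalAtlas 𝓘(ℝ, F) ∞ M) {x : M} (hx : x ∈ e.source)
    (hx' : x ∈ e'.source) : ContDiffAt ℝ ∞ (e' ∘ e.symm) (e x) := by
  have h1 := contMDiffAt_symm_of_mem_maximalAtlas he (e.map_source hx)
  have h2 : ContMDiffAt 𝓘(ℝ, F) 𝓘(ℝ, F) ∞ e' (e.symm (e x)) :=
    contMDiffAt_of_mem_maximalAtlas he' (by rwa [e.left_inv hx])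
  exact (h2.comp (e x) h1).contDiffAt

theorem chartDeriv_transition (he : e ∈ IsManifold.maximalAtlas 𝓘(ℝ, F) ∞ M)
    (he' : e' ∈ IsManifold.maximalAtlas 𝓘(ℝ, F) ∞ M) {x : M} (hx : x ∈ e.source)
    (hx' : x ∈ e'.source) (v : F) :
    chartDeriv e' x v =
      fderiv ℝ (e' ∘ e.symm) (e x) (chartDeriv e x v) := by
  have h1 : MDifferentiableAt 𝓘(ℝ, F) 𝓘(ℝ, F) (e' ∘ e.symm) (e x) :=
    ((contDiffAt_transition_of_mem_maximalAtlas he he' hx hx').differentiableAt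
      (by simp)).mdifferentiableAt
  have h2 := (mdifferentiable_of_mem_maximalAtlas he).mdifferentiableAt hx
  have h3 := h1.hasMFDerivAt.comp x h2.hasMFDerivAt
  have h4 : e' =ᶠ[𝓝 x] (e' ∘ e.symm) ∘ e := by
    filter_upwards [e.open_source.mem_nhds hx] with y hy
    simp [e.left_inv hy]
  have h5 := (h3.congr_of_eventuallyEq h4).mfderiv
  rw [mfderiv_eq_fderiv] at h5
  exact congrArg (fun A : F →L[ℝ] F => A v) h5

theorem tangentCoord_transition (he : e ∈ IsManifold.maximalAtlas 𝓘(ℝ, F) ∞ M)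
    (he' : e' ∈ IsManifold.maximalAtlas 𝓘(ℝ, F) ∞ M) {z : TangentBundle 𝓘(ℝ, F) M}
    (hz : z.proj ∈ e.source) (hz' : z.proj ∈ e'.source) :
    tangentCoord e' z = ((e' ∘ e.symm) (tangentCoord e z).1,
      fderiv ℝ (e' ∘ e.symm) (tangentCoord e z).1 (tangentCoord e z).2) := by
  refine Prod.ext ?_ (chartDeriv_transition he he' hz hz' z.snd)
  simp [tangentCoord, e.left_inv hz]

/-- Covectors transform contragrediently: the momenta for `e` are those for `e'` composed with the
derivative of the transition from `e` to `e'`, by the chain rule for the chart derivatives. -/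
theorem momentum_transition (he : e ∈ IsManifold.maximalAtlas 𝓘(ℝ, F) ∞ M)
    (he' : e' ∈ IsManifold.maximalAtlas 𝓘(ℝ, F) ∞ M) {s : CotangentBundle 𝓘(ℝ, F) M}
    (hs : s.proj ∈ e.source) (hs' : s.proj ∈ e'.source) :
    momentum e s = momentum e' s ∘L fderiv ℝ (e' ∘ e.symm) (e s.proj) := by
  ext v
  have h := chartDeriv_transition he he' hs hs'
    (chartDerivSymm e s.proj v)
  rw [chartDeriv_chartDerivSymm he hs] at h
  change (s.snd : F →L[ℝ] ℝ) _ = (s.snd : F →L[ℝ] ℝ) (chartDerivSymm e' s.proj (fderiv ℝ (e' ∘ e.symm) (e s.proj) v))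
  rw [← h, chartDerivSymm_chartDeriv he' hs']
  rfl

/-- The derivative of the tangent map of a smooth map between vector spaces. -/
theorem hasFDerivAt_tangentMap {φ : F → F} {u v : F} (h : ContDiffAt ℝ ∞ φ u) :
    HasFDerivAt (fun p : F × F => (φ p.1, fderiv ℝ φ p.1 p.2))
      (((fderiv ℝ φ u) ∘L ContinuousLinearMap.fst ℝ F F).prod
        (((fderiv ℝ (fderiv ℝ φ) u).flip v) ∘L ContinuousLinearMap.fst ℝ F F +
          fderiv ℝ φ u ∘L ContinuousLinearMap.snd ℝ F F)) (u, v) := by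
  have h1 : HasFDerivAt φ (fderiv ℝ φ u) u := (h.differentiableAt (by simp)).hasFDerivAt
  have h2 : HasFDerivAt (fderiv ℝ φ) (fderiv ℝ (fderiv ℝ φ) u) u :=
    ((h.fderiv_right (m := ∞) (by simp)).differentiableAt (by simp)).hasFDerivAt
  have hf : HasFDerivAt (fun p : F × F => p.1) (ContinuousLinearMap.fst ℝ F F) (u, v) :=
    hasFDerivAt_fst
  refine (h1.comp (f := fun p : F × F => p.1) (u, v) hf).prodMk ?_
  have := (h2.comp (f := fun p : F × F => p.1) (u, v) hf).clm_apply
    (hasFDerivAt_snd (𝕜 := ℝ) (E := F) (F := F) (p := (u, v)))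
  refine this.congr_fderiv ?_
  ext w <;> simp

variable [IsManifold 𝓘(ℝ, F) ∞ M]

theorem chartAt_mem_maximalAtlas (x : M) :
    chartAt F x ∈ IsManifold.maximalAtlas 𝓘(ℝ, F) ∞ M :=
  IsManifold.chart_mem_maximalAtlas x

/-- The trivialization of the tangent bundle at `x` acts on fibres as the derivative of the
preferred chart at `x`. This links the bundle structure, in which smoothness is defined, to
`tangentCoord`. -/
theorem trivializationAt_snd_eq {x : M} {z : TangentBundle 𝓘(ℝ, F) M}
    (hz : z.proj ∈ (chartAt F x).source) :
    (trivializationAt F (TangentSpace 𝓘(ℝ, F)) x z).2 = (tangentCoord (chartAt F x) z).2 := by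
  have hz' : z.proj ∈ (trivializationAt F (TangentSpace 𝓘(ℝ, F) : M → Type _) x).baseSet := hz
  have h := TangentBundle.continuousLinearMapAt_trivializationAt (I := 𝓘(ℝ, F)) hz
  have h2 := congrArg (fun A : F →L[ℝ] F => A z.snd) h
  have h3 : (Trivialization.continuousLinearMapAt ℝ
      (trivializationAt F (TangentSpace 𝓘(ℝ, F)) x) z.proj : F →L[ℝ] F) z.snd =
      (trivializationAt F (TangentSpace 𝓘(ℝ, F)) x z).2 := by
    rw [Trivialization.continuousLinearMapAt_apply, Trivialization.coe_linearMapAt_of_mem _ hz']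
  rw [← h3]
  refine h2.trans ?_
  simp [tangentCoord, extChartAt]
  rfl

theorem extChartAt_tangent_eq {z₀ z : TangentBundle 𝓘(ℝ, F) M}
    (hz : z.proj ∈ (chartAt F z₀.proj).source) :
    extChartAt 𝓘(ℝ, F).tangent z₀ z = tangentCoord (chartAt F z₀.proj) z := by
  erw [FiberBundle.extChartAt]
  refine Prod.ext ?_ (trivializationAt_snd_eq hz)
  simp [tangentCoord]

end Coordinates

/-! ### Smoothness, velocities and the Tulczyjew isomorphism in arbitrary charts -/

section SmoothCoordinates

variable {F : Type*} [NormedAddCommGroup F] [NormedSpace ℝ F]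
  {M : Type*} [TopologicalSpace M] [ChartedSpace F M] [IsManifold 𝓘(ℝ, F) ∞ M]
  {e e' : OpenPartialHomeomorph M F}

/-- A tangent vector at `x` is, as an element of `F`, its own component vector in the preferred
chart at `x`. This holds only at `x` itself and lets the raw fibre components used by
`tulczyjewAlpha` be read as coordinates. -/
theorem chartDeriv_chartAt_self (x : M) :
    chartDeriv (chartAt F x) x = ContinuousLinearMap.id ℝ F := by
  have h := mfderiv_extChartAt_self (I := 𝓘(ℝ, F)) (x := x)
  simp only [extChartAt, mfld_simps] at h
  exact h

theorem momentum_chartAt_self (s : CotangentBundle 𝓘(ℝ, F) M) :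
    momentum (chartAt F s.proj) s = s.snd := by
  ext v
  have h := chartDerivSymm_chartDeriv (chartAt_mem_maximalAtlas s.proj)
    (mem_chart_source F s.proj) v
  rw [chartDeriv_chartAt_self] at h
  exact congrArg (show F →L[ℝ] ℝ from s.snd) h

theorem contMDiffAt_tangentBundle_iff {N G H : Type*} [NormedAddCommGroup G] [NormedSpace ℝ G]
    [TopologicalSpace H] {I : ModelWithCorners ℝ G H} [TopologicalSpace N] [ChartedSpace H N]
    {n : WithTop ℕ∞} {f : N → TangentBundle 𝓘(ℝ, F) M} {y : N} :
    ContMDiffAt I 𝓘(ℝ, F).tangent n f y ↔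
      ContMDiffAt I 𝓘(ℝ, F) n (fun z => (f z).proj) y ∧
      ContMDiffAt I 𝓘(ℝ, F) n
        (fun z => (tangentCoord (chartAt F (f y).proj) (f z)).2) y := by
  rw [contMDiffAt_totalSpace]
  refine and_congr_right fun h => Filter.EventuallyEq.contMDiffAt_iff ?_
  have := h.continuousAt.eventually ((chartAt F (f y).proj).open_source.mem_nhds
    (mem_chart_source F (f y).proj))
  filter_upwards [this] with z hz
  exact trivializationAt_snd_eq hz

/-- The hom bundle reads a covector by composing it with the inverse trivialization of the tangent
bundle, and that inverse is the derivative of the inverse chart, as in `momentum`. -/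
theorem inCoordinates_eq_momentum {x : M} {s : CotangentBundle 𝓘(ℝ, F) M}
    (hs : s.proj ∈ (chartAt F x).source) :
    ContinuousLinearMap.inCoordinates F (TangentSpace 𝓘(ℝ, F)) ℝ (fun _ : M => ℝ) x s.proj x
      s.proj s.snd = momentum (chartAt F x) s := by
  have h := TangentBundle.symmL_trivializationAt (I := 𝓘(ℝ, F)) hs
  have h' : (Trivialization.symmL ℝ (trivializationAt F (TangentSpace 𝓘(ℝ, F))
      x) s.proj : F →L[ℝ] F) = chartDerivSymm (chartAt F x) s.proj := by
    refine h.trans ?_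
    simp [extChartAt, chartDerivSymm]
    rfl
  ext v
  have h2 := congrArg (fun A : F →L[ℝ] F => (show F →L[ℝ] ℝ from s.snd) (A v)) h'
  refine Eq.trans ?_ h2
  simp [ContinuousLinearMap.inCoordinates]
  rfl

theorem contMDiffAt_cotangentBundle_iff {N G H : Type*} [NormedAddCommGroup G] [NormedSpace ℝ G]
    [TopologicalSpace H] {I : ModelWithCorners ℝ G H} [TopologicalSpace N] [ChartedSpace H N]
    {n : WithTop ℕ∞} {f : N → CotangentBundle 𝓘(ℝ, F) M} {y : N} :
    ContMDiffAt I (cotangentModel 𝓘(ℝ, F)) n f y ↔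
      ContMDiffAt I 𝓘(ℝ, F) n (fun z => (f z).proj) y ∧
      ContMDiffAt I 𝓘(ℝ, F →L[ℝ] ℝ) n (fun z => momentum (chartAt F (f y).proj) (f z)) y := by
  rw [contMDiffAt_hom_bundle]
  refine and_congr_right fun h => Filter.EventuallyEq.contMDiffAt_iff ?_
  have := h.continuousAt.eventually ((chartAt F (f y).proj).open_source.mem_nhds
    (mem_chart_source F (f y).proj))
  filter_upwards [this] with z hz
  exact inCoordinates_eq_momentum hz

/-- Smoothness of a curve in `T*M` may be tested in the coordinates given by any chart. -/
theorem contMDiffAt_cotangentBundle_iff_of_mem_maximalAtlas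
    (he : e ∈ IsManifold.maximalAtlas 𝓘(ℝ, F) ∞ M) {f : ℝ → CotangentBundle 𝓘(ℝ, F) M} {t : ℝ}
    (ht : (f t).proj ∈ e.source) :
    ContMDiffAt 𝓘(ℝ, ℝ) (cotangentModel 𝓘(ℝ, F)) ∞ f t ↔
      ContMDiffAt 𝓘(ℝ, ℝ) 𝓘(ℝ, F) ∞ (fun s => (f s).proj) t ∧
      ContDiffAt ℝ ∞ (fun s => momentum e (f s)) t := by
  rw [contMDiffAt_cotangentBundle_iff]
  refine and_congr_right fun h => ?_
  rw [contMDiffAt_iff_contDiffAt]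
  set c := chartAt F (f t).proj
  have hc : c ∈ IsManifold.maximalAtlas 𝓘(ℝ, F) ∞ M := chartAt_mem_maximalAtlas (f t).proj
  have htc : (f t).proj ∈ c.source := mem_chart_source F (f t).proj
  -- The momenta in two charts differ by composition with the derivative of the transition map along
  -- the base curve. This factor is smooth in time, so smoothness passes from any chart to any
  -- other.
  have key : ∀ {a b : OpenPartialHomeomorph M F} (_ : a ∈ IsManifold.maximalAtlas 𝓘(ℝ, F) ∞ M)
      (_ : b ∈ IsManifold.maximalAtlas 𝓘(ℝ, F) ∞ M), (f t).proj ∈ a.source →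
      (f t).proj ∈ b.source → ContDiffAt ℝ ∞ (fun s => momentum a (f s)) t →
      ContDiffAt ℝ ∞ (fun s => momentum b (f s)) t := by
    intro a b ha hb hta htb hs
    have h1 : ContDiffAt ℝ ∞ (fun s => b (f s).proj) t :=
      ((contMDiffAt_of_mem_maximalAtlas hb htb).comp t h).contDiffAt
    have h2 : ContDiffAt ℝ ∞ (fun s => fderiv ℝ (a ∘ b.symm) (b (f s).proj)) t :=
      ((contDiffAt_transition_of_mem_maximalAtlas hb ha htb hta).fderiv_right (m := ∞)
        (by simp)).comp t h1
    refine (hs.clm_comp h2).congr_of_eventuallyEq ?_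
    filter_upwards [h.continuousAt.eventually (a.open_source.mem_nhds hta),
      h.continuousAt.eventually (b.open_source.mem_nhds htb)] with s hsa hsb
    exact momentum_transition hb ha hsb hsa
  exact ⟨key hc he htc ht, key he hc ht htc⟩

/-- The derivative of the natural coordinates `(q, q̇)` of `TM`. -/
def tangentCoordDeriv (e : OpenPartialHomeomorph M F) (z : TangentBundle 𝓘(ℝ, F) M) :
    F × F →L[ℝ] F × F :=
  mfderiv 𝓘(ℝ, F).tangent 𝓘(ℝ, F × F) (tangentCoord e) z

/-- Near `z` the coordinates induced by `e` are the tangent map of the transition map applied to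
those of the preferred chart, and the preferred chart of the tangent bundle at `z` has identity
derivative at `z`. -/
theorem hasMFDerivAt_tangentCoord (he : e ∈ IsManifold.maximalAtlas 𝓘(ℝ, F) ∞ M)
    {z : TangentBundle 𝓘(ℝ, F) M} (hz : z.proj ∈ e.source) :
    HasMFDerivAt 𝓘(ℝ, F).tangent 𝓘(ℝ, F × F) (tangentCoord e) z
      (fderiv ℝ (fun p : F × F => ((e ∘ (chartAt F z.proj).symm) p.1,
        fderiv ℝ (e ∘ (chartAt F z.proj).symm) p.1 p.2))
          (tangentCoord (chartAt F z.proj) z)) := by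
  set c := chartAt F z.proj
  have hc : c ∈ IsManifold.maximalAtlas 𝓘(ℝ, F) ∞ M := chartAt_mem_maximalAtlas z.proj
  have hzc : z.proj ∈ c.source := mem_chart_source F z.proj
  have h1 := (mdifferentiableAt_extChartAt (I := 𝓘(ℝ, F).tangent)
    (mem_chart_source (ModelProd F F) z)).hasMFDerivAt
  rw [mfderiv_extChartAt_self] at h1
  have hs : ∀ᶠ w in 𝓝 z, w.proj ∈ c.source ∧ w.proj ∈ e.source :=
    (FiberBundle.continuous_proj F (TangentSpace 𝓘(ℝ, F) : M → Type _)).continuousAt.eventually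
      ((c.open_source.inter e.open_source).mem_nhds ⟨hzc, hz⟩)
  have h2 : extChartAt 𝓘(ℝ, F).tangent z =ᶠ[𝓝 z] tangentCoord c := by
    filter_upwards [hs] with w hw
    exact extChartAt_tangent_eq hw.1
  have hφ := (hasFDerivAt_tangentMap (v := (tangentCoord c z).2)
    (contDiffAt_transition_of_mem_maximalAtlas hc he hzc hz)).differentiableAt.hasFDerivAt
  have h3 := (hφ.hasMFDerivAt.comp z (h1.congr_of_eventuallyEq h2.symm))
  refine (h3.congr_of_eventuallyEq ?_)
  filter_upwards [hs] with w hw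
  exact tangentCoord_transition hc he hw.1 hw.2

theorem tangentCoord_chartAt_self (x : M) (v : F) :
    tangentCoord (chartAt F x) (⟨x, v⟩ : TangentBundle 𝓘(ℝ, F) M) = (chartAt F x x, v) := by
  simp only [tangentCoord, chartDeriv_chartAt_self]
  rfl

/-- The second-derivative term records that a vector with fixed fibre component in one chart has a
varying one in another. It is the term that the change of momenta must match in
`tulczyjewAlpha_velocity`. -/
theorem tangentCoordDeriv_apply (he : e ∈ IsManifold.maximalAtlas 𝓘(ℝ, F) ∞ M)
    {x : M} (hx : x ∈ e.source) (v a b : F) :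
    tangentCoordDeriv e ⟨x, v⟩ (a, b) =
      (fderiv ℝ (e ∘ (chartAt F x).symm) (chartAt F x x) a,
        fderiv ℝ (fderiv ℝ (e ∘ (chartAt F x).symm)) (chartAt F x x) a v +
        fderiv ℝ (e ∘ (chartAt F x).symm) (chartAt F x x) b) := by
  have h1 : tangentCoordDeriv e ⟨x, v⟩ = fderiv ℝ (fun p : F × F =>
      ((e ∘ (chartAt F x).symm) p.1, fderiv ℝ (e ∘ (chartAt F x).symm) p.1 p.2))
        (tangentCoord (chartAt F x) (⟨x, v⟩ : TangentBundle 𝓘(ℝ, F) M)) :=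
    (hasMFDerivAt_tangentCoord (z := (⟨x, v⟩ : TangentBundle 𝓘(ℝ, F) M)) he hx).mfderiv
  rw [h1, tangentCoord_chartAt_self, (hasFDerivAt_tangentMap
    (contDiffAt_transition_of_mem_maximalAtlas (chartAt_mem_maximalAtlas x) he
      (mem_chart_source F x) hx)).fderiv]
  simp

omit [IsManifold 𝓘(ℝ, F) ∞ M] in
theorem tangentCoord_velocity (he : e ∈ IsManifold.maximalAtlas 𝓘(ℝ, F) ∞ M) {x : ℝ → M} {t : ℝ}
    (hx : MDifferentiableAt 𝓘(ℝ, ℝ) 𝓘(ℝ, F) x t) (ht : x t ∈ e.source) :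
    tangentCoord e (velocity 𝓘(ℝ, F) x t) = (e (x t), deriv (e ∘ x) t) := by
  have h1 := ((mdifferentiable_of_mem_maximalAtlas he).mdifferentiableAt ht).hasMFDerivAt
  have h2 := (h1.comp t hx.hasMFDerivAt).mfderiv
  rw [mfderiv_eq_fderiv] at h2
  refine Prod.ext rfl ?_
  have h3 := congrArg (fun A : ℝ →L[ℝ] F => A 1) h2
  exact h3.symm.trans rfl

/-- The Tulczyjew isomorphism in the natural coordinates induced by an arbitrary chart. -/
theorem tulczyjewAlpha_velocity (he : e ∈ IsManifold.maximalAtlas 𝓘(ℝ, F) ∞ M)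
    {f : ℝ → CotangentBundle 𝓘(ℝ, F) M} {t : ℝ}
    (hf : ContMDiffAt 𝓘(ℝ, ℝ) (cotangentModel 𝓘(ℝ, F)) ∞ f t) (ht : (f t).proj ∈ e.source) :
    tulczyjewAlpha (velocity (cotangentModel 𝓘(ℝ, F)) f t) =
      ⟨velocity 𝓘(ℝ, F) (fun s => (f s).proj) t,
        ((deriv (fun s => momentum e (f s)) t).coprod (momentum e (f t))) ∘L
          tangentCoordDeriv e (velocity 𝓘(ℝ, F) (fun s => (f s).proj) t)⟩ := by
  set c := chartAt F (f t).proj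
  have hc : c ∈ IsManifold.maximalAtlas 𝓘(ℝ, F) ∞ M := chartAt_mem_maximalAtlas (f t).proj
  have htc : (f t).proj ∈ c.source := mem_chart_source F (f t).proj
  obtain ⟨hx, hp⟩ := (contMDiffAt_cotangentBundle_iff_of_mem_maximalAtlas he ht).1 hf
  have hx' : MDifferentiableAt 𝓘(ℝ, ℝ) 𝓘(ℝ, F) (fun s => (f s).proj) t :=
    hx.mdifferentiableAt (by simp)
  -- The velocities are named with the model spaces as their types, so that their components can be
  -- taken.
  obtain ⟨D, hD⟩ : ∃ D : F × (F →L[ℝ] ℝ), D =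
    mfderiv 𝓘(ℝ, ℝ) (cotangentModel 𝓘(ℝ, F)) f t (1 : ℝ) := ⟨_, rfl⟩
  obtain ⟨v, hv⟩ : ∃ v : F, v = mfderiv 𝓘(ℝ, ℝ) 𝓘(ℝ, F) (fun s => (f s).proj) t (1 : ℝ) :=
    ⟨_, rfl⟩
  have hchart := hasDerivAt_chart (hf.mdifferentiableAt (by simp))
  rw [← hD, FiberBundle.extChartAt] at hchart
  have hmem : ∀ᶠ s in 𝓝 t, (f s).proj ∈ c.source ∧ (f s).proj ∈ e.source :=
    hx.continuousAt.eventually ((c.open_source.inter e.open_source).mem_nhds ⟨htc, ht⟩)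
  have hD1 : HasDerivAt (fun s => c (f s).proj) D.1 t := by
    have := (ContinuousLinearMap.fst ℝ F (F →L[ℝ] ℝ)).hasFDerivAt.comp_hasDerivAt t hchart
    simpa [hom_trivializationAt_apply, Function.comp_def] using this
  have hD2 : HasDerivAt (fun s => momentum c (f s)) D.2 t := by
    have := (ContinuousLinearMap.snd ℝ F (F →L[ℝ] ℝ)).hasFDerivAt.comp_hasDerivAt t hchart
    refine this.congr_of_eventuallyEq ?_
    filter_upwards [hmem] with s hs
    simpa [hom_trivializationAt_apply] using (inCoordinates_eq_momentum hs.1).symm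
  have hv1 : D.1 = v := by
    have := hasDerivAt_chart hx'
    rw [← hv] at this
    refine hD1.unique (this.congr_of_eventuallyEq (Eventually.of_forall fun s => ?_))
    simp [c]
  set φ := e ∘ c.symm
  have hφ : ContDiffAt ℝ ∞ φ (c (f t).proj) :=
    contDiffAt_transition_of_mem_maximalAtlas hc he htc ht
  have hφ2 : HasFDerivAt (fderiv ℝ φ) (fderiv ℝ (fderiv ℝ φ) (c (f t).proj)) (c (f t).proj) :=
    ((hφ.fderiv_right (m := ∞) (by simp)).differentiableAt (by simp)).hasFDerivAt
  have hP : HasDerivAt (fun s => momentum e (f s)) (deriv (fun s => momentum e (f s)) t) t :=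
    (hp.differentiableAt (by simp)).hasDerivAt
  -- The product rule applied to p_c = p_e ∘ Dφ along the curve: ṗ_c = ṗ_e ∘ Dφ + p_e ∘ D²φ(v).
  have hD3 := (hP.clm_comp (hφ2.comp_hasDerivAt t hD1)).unique (hD2.congr_of_eventuallyEq (by
    filter_upwards [hmem] with s hs
    exact (momentum_transition hc he hs.1 hs.2).symm))
  have h0 : momentum e (f t) ∘L fderiv ℝ φ (c (f t).proj) = (show F →L[ℝ] ℝ from (f t).snd) :=
    (momentum_transition hc he htc ht).symm.trans (momentum_chartAt_self (f t))
  -- Differentiating the momenta puts the velocity `v` in the first argument of D²φ, while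
  -- `tangentCoordDeriv` puts it in the second. Symmetry of D²φ identifies the two terms.
  have hsymm := hφ.isSymmSndFDerivAt (n := ∞) (by simpa using ENat.LEInfty.out)
  have hvel : velocity 𝓘(ℝ, F) (fun s => (f s).proj) t = ⟨(f t).proj, v⟩ := by rw [hv]; rfl
  have halpha : tulczyjewAlpha (velocity (cotangentModel 𝓘(ℝ, F)) f t) =
      ⟨⟨(f t).proj, v⟩, (D.2.coprod (show F →L[ℝ] ℝ from (f t).snd) : F × F →L[ℝ] ℝ)⟩ := by
    rw [← hv1, hD]
    rfl
  rw [hvel, halpha]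
  refine congrArg (fun A : F × F →L[ℝ] ℝ => (⟨⟨(f t).proj, v⟩, A⟩ :
    CotangentBundle 𝓘(ℝ, F).tangent (TangentBundle 𝓘(ℝ, F) M))) ?_
  refine ContinuousLinearMap.ext fun w => ?_
  obtain ⟨a, b⟩ := w
  have h5 := congrArg ((deriv (fun s => momentum e (f s)) t).coprod (momentum e (f t)))
    (tangentCoordDeriv_apply he ht v a b)
  refine Eq.trans ?_ h5.symm
  have h6 : fderiv ℝ (fderiv ℝ φ) (c (f t).proj) v a = fderiv ℝ (fderiv ℝ φ) (c (f t).proj) a v :=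
    hsymm v a
  rw [← hD3, ← h0, hv1]
  simp [h6, c, φ]
  ring

/-- A covector on `TM` in natural coordinates. -/
theorem inCoordinates_comp_tangentCoordDeriv {z₀ z : TangentBundle 𝓘(ℝ, F) M}
    (hz : z.proj ∈ (chartAt F z₀.proj).source) (A : F × F →L[ℝ] ℝ) :
    ContinuousLinearMap.inCoordinates (F × F) (TangentSpace 𝓘(ℝ, F).tangent) ℝ
      (fun _ : TangentBundle 𝓘(ℝ, F) M => ℝ) z₀ z z₀ z
      (A ∘L tangentCoordDeriv (chartAt F z₀.proj) z : F × F →L[ℝ] ℝ) = A := by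
  have hz' : z ∈ (chartAt (ModelProd F F) z₀).source :=
    (TangentBundle.mem_chart_source_iff _ _).2 hz
  have h1 := TangentBundle.continuousLinearMapAt_trivializationAt (I := 𝓘(ℝ, F).tangent) hz'
  have h2 : extChartAt 𝓘(ℝ, F).tangent z₀ =ᶠ[𝓝 z] tangentCoord (chartAt F z₀.proj) := by
    have := (FiberBundle.continuous_proj F
      (TangentSpace 𝓘(ℝ, F) : M → Type _)).continuousAt.eventually
      ((chartAt F z₀.proj).open_source.mem_nhds hz)
    filter_upwards [this] with w hw
    exact extChartAt_tangent_eq hw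
  have h3 : (Trivialization.continuousLinearMapAt ℝ (trivializationAt (F × F)
      (TangentSpace 𝓘(ℝ, F).tangent) z₀) z : F × F →L[ℝ] F × F) =
      tangentCoordDeriv (chartAt F z₀.proj) z := h1.trans h2.mfderiv_eq
  refine ContinuousLinearMap.ext fun w => ?_
  have h4 := (trivializationAt (F × F) (TangentSpace 𝓘(ℝ, F).tangent)
    z₀).continuousLinearMapAt_symmL (R := ℝ) (b := z) hz' w
  have h5 : (Trivialization.continuousLinearMapAt ℝ (trivializationAt (F × F)
      (TangentSpace 𝓘(ℝ, F).tangent) z₀) z : F × F →L[ℝ] F × F)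
      (((trivializationAt (F × F) (TangentSpace 𝓘(ℝ, F).tangent) z₀).symmL ℝ z :
        F × F →L[ℝ] F × F) w) = w := h4
  rw [h3] at h5
  refine Eq.trans ?_ (congrArg A h5)
  simp [ContinuousLinearMap.inCoordinates]
  rfl

theorem contMDiffAt_velocity {x : ℝ → M} {t : ℝ}
    (hx : ∀ᶠ s in 𝓝 t, ContMDiffAt 𝓘(ℝ, ℝ) 𝓘(ℝ, F) ∞ x s) :
    ContMDiffAt 𝓘(ℝ, ℝ) 𝓘(ℝ, F).tangent ∞ (velocity 𝓘(ℝ, F) x) t := by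
  rw [contMDiffAt_tangentBundle_iff]
  refine ⟨hx.self_of_nhds, ?_⟩
  rw [contMDiffAt_iff_contDiffAt]
  set c := chartAt F (x t)
  have hc : c ∈ IsManifold.maximalAtlas 𝓘(ℝ, F) ∞ M := chartAt_mem_maximalAtlas (x t)
  have htc : x t ∈ c.source := mem_chart_source F (x t)
  have h1 : ContDiffAt ℝ ∞ (deriv (c ∘ x)) t := by
    have := ((contMDiffAt_of_mem_maximalAtlas hc htc).comp t hx.self_of_nhds).contDiffAt
    have h2 := (this.fderiv_right (m := ∞) (by simp)).clm_apply
      (contDiffAt_const (c := (1 : ℝ)))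
    exact h2
  refine h1.congr_of_eventuallyEq ?_
  filter_upwards [hx, hx.self_of_nhds.continuousAt.eventually (c.open_source.mem_nhds htc)]
    with s hs hs'
  exact congrArg Prod.snd (tangentCoord_velocity hc (hs.mdifferentiableAt (by simp)) hs')

/-- If `f` is a smooth curve in `T*M`, then `α ∘ df/dt` is smooth. -/
theorem contMDiffAt_tulczyjewAlpha_velocity {f : ℝ → CotangentBundle 𝓘(ℝ, F) M} {t : ℝ}
    (hf : ∀ᶠ s in 𝓝 t, ContMDiffAt 𝓘(ℝ, ℝ) (cotangentModel 𝓘(ℝ, F)) ∞ f s) :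
    ContMDiffAt 𝓘(ℝ, ℝ) (cotangentModel 𝓘(ℝ, F).tangent) ∞
      (fun s => tulczyjewAlpha (velocity (cotangentModel 𝓘(ℝ, F)) f s)) t := by
  set c := chartAt F (f t).proj
  have hc : c ∈ IsManifold.maximalAtlas 𝓘(ℝ, F) ∞ M := chartAt_mem_maximalAtlas (f t).proj
  have htc : (f t).proj ∈ c.source := mem_chart_source F (f t).proj
  have hx : ∀ᶠ s in 𝓝 t, ContMDiffAt 𝓘(ℝ, ℝ) 𝓘(ℝ, F) ∞ (fun s => (f s).proj) s :=
    hf.mono fun s hs => (contMDiffAt_cotangentBundle_iff.1 hs).1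
  have hsrc := hx.self_of_nhds.continuousAt.eventually (c.open_source.mem_nhds htc)
  have hp := (contMDiffAt_iff_contDiffAt.1 (contMDiffAt_cotangentBundle_iff.1 hf.self_of_nhds).2)
  have hp' : ContDiffAt ℝ ∞ (deriv fun s => momentum c (f s)) t :=
    (hp.fderiv_right (m := ∞) (by simp)).clm_apply (contDiffAt_const (c := (1 : ℝ)))
  have hev : (fun s => tulczyjewAlpha (velocity (cotangentModel 𝓘(ℝ, F)) f s)) =ᶠ[𝓝 t] fun s =>
      (⟨velocity 𝓘(ℝ, F) (fun s => (f s).proj) s,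
        ((deriv (fun s => momentum c (f s)) s).coprod (momentum c (f s))) ∘L
          tangentCoordDeriv c (velocity 𝓘(ℝ, F) (fun s => (f s).proj) s)⟩ :
        CotangentBundle 𝓘(ℝ, F).tangent (TangentBundle 𝓘(ℝ, F) M)) := by
    filter_upwards [hf, hsrc] with s hs hs'
    exact tulczyjewAlpha_velocity hc hs hs'
  refine ContMDiffAt.congr_of_eventuallyEq ?_ hev
  -- Read in the bundle coordinates over the fixed chart `c`, the fibre part of the curve is just
  -- the pair (ṗ, p), and the base part is a velocity.
  rw [contMDiffAt_hom_bundle]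
  refine ⟨contMDiffAt_velocity hx, ?_⟩
  have h1 : ContDiffAt ℝ ∞ (fun s => (deriv (fun s => momentum c (f s)) s).coprod
      (momentum c (f s))) t := by
    have h2 := (hp'.clm_comp (contDiffAt_const (c := ContinuousLinearMap.fst ℝ F F))).add
      (hp.clm_comp (contDiffAt_const (c := ContinuousLinearMap.snd ℝ F F)))
    refine h2.congr_of_eventuallyEq (Eventually.of_forall fun s => ?_)
    ext <;> simp [c]
  refine h1.contMDiffAt.congr_of_eventuallyEq ?_
  filter_upwards [hsrc] with s hs
  exact inCoordinates_comp_tangentCoordDeriv (z₀ := velocity 𝓘(ℝ, F) (fun s => (f s).proj) t)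
    (z := velocity 𝓘(ℝ, F) (fun s => (f s).proj) s) hs _

end SmoothCoordinates

/-! ### Calculus of curves -/

section Calculus

variable {V W : Type*} [NormedAddCommGroup V] [NormedSpace ℝ V] [NormedAddCommGroup W]
  [NormedSpace ℝ W]

theorem contDiffAt_deriv {c : ℝ → V} {t : ℝ} (h : ContDiffAt ℝ ∞ c t) :
    ContDiffAt ℝ ∞ (deriv c) t :=
  (h.fderiv_right (m := ∞) (by simp)).clm_apply (contDiffAt_const (c := (1 : ℝ)))

theorem contDiffAt_iteratedDeriv {c : ℝ → V} {t : ℝ} (h : ContDiffAt ℝ ∞ c t) (j : ℕ) :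
    ContDiffAt ℝ ∞ (iteratedDeriv j c) t := by
  induction j with
  | zero => simpa using h
  | succ j ih => rw [iteratedDeriv_succ]; exact contDiffAt_deriv ih

/-- The Jacobi-Ostrogradsky momenta `∑ᵢ (-1)ⁱ dⁱ/dtⁱ ℓ_{m+i}`, where `m + i < N`. -/
def ostrogradsky (ℓ : ℕ → ℝ → V) (N m : ℕ) (t : ℝ) : V :=
  ∑ i ∈ Finset.range (N - m), (-1 : ℝ) ^ i • iteratedDeriv i (ℓ (m + i)) t

theorem ostrogradsky_self (ℓ : ℕ → ℝ → V) (N : ℕ) : ostrogradsky ℓ N N = 0 := by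
  funext t
  simp [ostrogradsky]

theorem contDiffAt_ostrogradsky {ℓ : ℕ → ℝ → V} {t : ℝ} (h : ∀ n, ContDiffAt ℝ ∞ (ℓ n) t)
    (N m : ℕ) : ContDiffAt ℝ ∞ (ostrogradsky ℓ N m) t :=
  ContDiffAt.sum fun i _ => contDiffAt_const.smul (contDiffAt_iteratedDeriv (h (m + i)) i)

/-- Differentiating the sum of index `m + 1` raises each order by one. After reindexing, its terms
are the terms of index `m` with opposite sign, so only the term `i = 0`, which is `ℓ m`, survives.
-/
theorem ostrogradsky_add_deriv {ℓ : ℕ → ℝ → V} {t : ℝ} (h : ∀ n, ContDiffAt ℝ ∞ (ℓ n) t)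
    {N m : ℕ} (hm : m < N) :
    ostrogradsky ℓ N m t + deriv (ostrogradsky ℓ N (m + 1)) t = ℓ m t := by
  obtain ⟨d, rfl⟩ : ∃ d, N = m + d + 1 := ⟨N - m - 1, by omega⟩
  have hd : HasDerivAt (ostrogradsky ℓ (m + d + 1) (m + 1))
      (∑ i ∈ Finset.range d, (-1 : ℝ) ^ i • iteratedDeriv (i + 1) (ℓ (m + 1 + i)) t) t := by
    have : ostrogradsky ℓ (m + d + 1) (m + 1) = fun s =>
        ∑ i ∈ Finset.range d, (-1 : ℝ) ^ i • iteratedDeriv i (ℓ (m + 1 + i)) s := by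
      funext s
      simp only [ostrogradsky, show m + d + 1 - (m + 1) = d by omega]
    rw [this]
    refine HasDerivAt.fun_sum fun i _ => ?_
    rw [iteratedDeriv_succ]
    exact (((contDiffAt_iteratedDeriv (h (m + 1 + i)) i).differentiableAt
      (by simp)).hasDerivAt).const_smul _
  rw [hd.deriv, ostrogradsky, show m + d + 1 - m = d + 1 by omega, Finset.sum_range_succ']
  have e1 : ∀ i, (-1 : ℝ) ^ (i + 1) • iteratedDeriv (i + 1) (ℓ (m + (i + 1))) t =
      -((-1 : ℝ) ^ i • iteratedDeriv (i + 1) (ℓ (m + 1 + i)) t) := by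
    intro i
    rw [pow_succ, mul_neg_one, neg_smul, show m + (i + 1) = m + 1 + i by ring]
  simp only [e1, Finset.sum_neg_distrib, pow_zero, one_smul, iteratedDeriv_zero, add_zero]
  abel

/-- The momenta are determined by the Euler-Lagrange recursion. -/
theorem eventuallyEq_ostrogradsky {ℓ p : ℕ → ℝ → V} {t : ℝ} {N : ℕ}
    (h : ∀ᶠ s in 𝓝 t, ∀ n, ContDiffAt ℝ ∞ (ℓ n) s)
    (hp : ∀ᶠ s in 𝓝 t, ∀ n < N, p n s + deriv (p (n + 1)) s = ℓ n s)
    (hN : ∀ᶠ s in 𝓝 t, p N s = 0) {m : ℕ} (hm : m ≤ N) :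
    p m =ᶠ[𝓝 t] ostrogradsky ℓ N m := by
  -- The recursion gives `p m` from the derivative of `p (m + 1)`, so the induction descends from
  -- `N` and carries equality of germs, which may be differentiated.
  induction hm using Nat.decreasingInduction with
  | self => rw [ostrogradsky_self]; exact hN
  | of_succ m hm ih =>
    filter_upwards [h, hp, ih.deriv] with s hs hs' hs''
    rw [eq_sub_of_add_eq (hs' m hm), eq_sub_of_add_eq (ostrogradsky_add_deriv hs hm), hs'']

end Calculus

/-! ### Linear algebra in natural coordinates -/

section Linear

variable (E : Type*) [NormedAddCommGroup E] [NormedSpace ℝ E] (k : ℕ)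

/-- The map `(q_{(0)}, …, q_{(k+1)}) ↦ (q_{(0)}, …, q_{(k)})`. -/
def truncate : (Fin (k + 1 + 1) → E) →L[ℝ] (Fin (k + 1) → E) :=
  ContinuousLinearMap.pi fun j => ContinuousLinearMap.proj j.castSucc

/-- The map `(q_{(0)}, …, q_{(k+1)}) ↦ (q_{(1)}, …, q_{(k+1)})`. -/
def shift : (Fin (k + 1 + 1) → E) →L[ℝ] (Fin (k + 1) → E) :=
  ContinuousLinearMap.pi fun j => ContinuousLinearMap.proj j.succ

/-- The canonical immersion in natural coordinates. -/
def immersionCoord : (Fin (k + 1 + 1) → E) →L[ℝ] (Fin (k + 1) → E) × (Fin (k + 1) → E) :=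
  (truncate E k).prod (shift E k)

variable {E k}

theorem immersionCoord_apply (c : Fin (k + 1 + 1) → E) :
    immersionCoord E k c = (fun j => c j.castSucc, fun j => c j.succ) := rfl

theorem immersionCoord_injective : Function.Injective (immersionCoord E k) := by
  intro c c' h
  rw [immersionCoord_apply, immersionCoord_apply] at h
  funext j
  rcases Fin.eq_castSucc_or_eq_last j with ⟨i, rfl⟩ | rfl
  · exact congrFun (congrArg Prod.fst h) i
  · exact congrFun (congrArg Prod.snd h) (Fin.last k)

variable (E k) in
/-- The component `p^{(n-1)}` of a covector on `T^{(k)}Q`, extended by zero. -/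
def momentumComponent : ℕ → ((Fin (k + 1) → E) →L[ℝ] ℝ) →L[ℝ] (E →L[ℝ] ℝ)
  | 0 => 0
  | n + 1 => if h : n < k + 1 then
      (ContinuousLinearMap.compL ℝ E (Fin (k + 1) → E) ℝ).flip
        (ContinuousLinearMap.single ℝ (fun _ : Fin (k + 1) => E) ⟨n, h⟩) else 0

theorem momentumComponent_zero (A : (Fin (k + 1) → E) →L[ℝ] ℝ) :
    momentumComponent E k 0 A = 0 := rfl

theorem momentumComponent_succ {n : ℕ} (h : n < k + 1) (A : (Fin (k + 1) → E) →L[ℝ] ℝ) :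
    momentumComponent E k (n + 1) A =
      A ∘L ContinuousLinearMap.single ℝ (fun _ : Fin (k + 1) => E) ⟨n, h⟩ := by
  rw [momentumComponent, dif_pos h]
  rfl

theorem momentumComponent_of_lt {n : ℕ} (h : k + 1 < n) (A : (Fin (k + 1) → E) →L[ℝ] ℝ) :
    momentumComponent E k n A = 0 := by
  obtain ⟨m, rfl⟩ : ∃ m, n = m + 1 := ⟨n - 1, by omega⟩
  rw [momentumComponent, dif_neg (by omega)]
  rfl

theorem clm_pi_ext {n : ℕ} {A B : (Fin n → E) →L[ℝ] ℝ}
    (h : ∀ j, A ∘L ContinuousLinearMap.single ℝ (fun _ : Fin n => E) j =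
      B ∘L ContinuousLinearMap.single ℝ (fun _ : Fin n => E) j) : A = B := by
  apply ContinuousLinearMap.coe_injective
  refine LinearMap.pi_ext' fun j => ?_
  ext v
  exact congrArg (fun C : E →L[ℝ] ℝ => C v) (h j)

theorem clm_ext_momentumComponent {A B : (Fin (k + 1) → E) →L[ℝ] ℝ}
    (h : ∀ n, momentumComponent E k n A = momentumComponent E k n B) : A = B := by
  refine clm_pi_ext fun j => ?_
  have := h (j + 1)
  rwa [momentumComponent_succ j.2, momentumComponent_succ j.2] at this

theorem momentumComponent_sum {n : ℕ} (f : ℕ → E →L[ℝ] ℝ) (h : n < k + 1) :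
    momentumComponent E k (n + 1) (∑ j : Fin (k + 1),
      f (j + 1) ∘L ContinuousLinearMap.proj (R := ℝ) (φ := fun _ : Fin (k + 1) => E) j) =
        f (n + 1) := by
  rw [momentumComponent_succ h]
  ext v
  simp only [ContinuousLinearMap.comp_apply, sum_apply,
    ContinuousLinearMap.single_apply, ContinuousLinearMap.proj_apply]
  rw [Finset.sum_eq_single ⟨n, h⟩]
  · simp
  · intro j _ hj
    simp [hj]
  · simp

/-- The equation `j* μ = dL` in natural coordinates. -/
theorem coprod_comp_immersionCoord_eq_iff (A A' : (Fin (k + 1) → E) →L[ℝ] ℝ)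
    (D : (Fin (k + 1 + 1) → E) →L[ℝ] ℝ) :
    (A'.coprod A) ∘L immersionCoord E k = D ↔ ∀ (n : ℕ) (h : n < k + 1 + 1),
      momentumComponent E k n A + momentumComponent E k (n + 1) A' =
        D ∘L ContinuousLinearMap.single ℝ (fun _ : Fin (k + 1 + 1) => E) ⟨n, h⟩ := by
  -- The shift forgets the slot 0 and the truncation forgets the slot `k + 1`. The components set to
  -- zero outside the range, `momentumComponent` at 0 and at `k + 2`, make one formula hold at both
  -- ends.
  have h1 : ∀ (n : ℕ) (h : n < k + 1 + 1), momentumComponent E k n A = A ∘L shift E k ∘L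
      ContinuousLinearMap.single ℝ (fun _ : Fin (k + 1 + 1) => E) ⟨n, h⟩ := by
    intro n h
    ext v
    cases n with
    | zero =>
      have : shift E k (Pi.single ⟨0, h⟩ v) = 0 := by
        funext j
        change (Pi.single (⟨0, h⟩ : Fin (k + 1 + 1)) v : Fin (k + 1 + 1) → E) j.succ = 0
        exact Pi.single_eq_of_ne (Fin.succ_ne_zero j) v
      rw [momentumComponent_zero, ContinuousLinearMap.comp_apply, ContinuousLinearMap.comp_apply,
        ContinuousLinearMap.single_apply, this]
      simp
    | succ n =>
      have : shift E k (Pi.single ⟨n + 1, h⟩ v) = Pi.single ⟨n, by omega⟩ v := by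
        funext j
        change (Pi.single (⟨n + 1, h⟩ : Fin (k + 1 + 1)) v : Fin (k + 1 + 1) → E) j.succ = _
        simp [Pi.single_apply, Fin.ext_iff]
      simp [this, momentumComponent_succ (show n < k + 1 by omega)]
  have h2 : ∀ (n : ℕ) (h : n < k + 1 + 1), momentumComponent E k (n + 1) A' = A' ∘L
      truncate E k ∘L
      ContinuousLinearMap.single ℝ (fun _ : Fin (k + 1 + 1) => E) ⟨n, h⟩ := by
    intro n h
    ext v
    by_cases hn : n < k + 1
    · have : truncate E k (Pi.single ⟨n, h⟩ v) = Pi.single ⟨n, hn⟩ v := by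
        funext j
        change (Pi.single (⟨n, h⟩ : Fin (k + 1 + 1)) v : Fin (k + 1 + 1) → E) j.castSucc = _
        simp [Pi.single_apply, Fin.ext_iff]
      simp [this, momentumComponent_succ hn]
    · have : truncate E k (Pi.single ⟨n, h⟩ v) = 0 := by
        funext j
        change (Pi.single (⟨n, h⟩ : Fin (k + 1 + 1)) v : Fin (k + 1 + 1) → E) j.castSucc = 0
        have hj : j.castSucc ≠ (⟨n, h⟩ : Fin (k + 1 + 1)) := fun hj => by
          have := congrArg Fin.val hj
          simp at this
          omega
        simp [hj]
      simp [this, momentumComponent_of_lt (show k + 1 < n + 1 by omega)]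
  have h3 : ∀ (n : ℕ) (h : n < k + 1 + 1),
      momentumComponent E k n A + momentumComponent E k (n + 1) A' =
      ((A'.coprod A) ∘L immersionCoord E k) ∘L
        ContinuousLinearMap.single ℝ (fun _ : Fin (k + 1 + 1) => E) ⟨n, h⟩ := by
    intro n h
    rw [h1 n h, h2 n h]
    ext v
    simp [immersionCoord, add_comm]
  constructor
  · rintro rfl n h
    exact h3 n h
  · intro H
    exact clm_pi_ext fun j => (h3 j j.2).symm.trans (H j j.2)

end Linear

/-! ### The canonical immersion in natural coordinates -/

section Immersion

variable {E : Type*} [NormedAddCommGroup E] [NormedSpace ℝ E]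
  {Q : Type*} [TopologicalSpace Q] [ChartedSpace E Q]

theorem smoothNear_of_contMDiffOn {γ : ℝ → Q} {I : Set ℝ} (hI : IsOpen I)
    (hγ : ContMDiffOn 𝓘(ℝ, ℝ) 𝓘(ℝ, E) ∞ γ I) {t : ℝ} (ht : t ∈ I) : SmoothNear E γ t := by
  filter_upwards [hI.mem_nhds ht] with s hs
  exact hγ.contMDiffAt (hI.mem_nhds hs)

variable [IsManifold 𝓘(ℝ, E) ∞ Q] {k : ℕ} {e : OpenPartialHomeomorph Q E}

namespace HOTangent

theorem natChart_mem_maximalAtlas (he : e ∈ atlas E Q) :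
    natChart k e he ∈
      IsManifold.maximalAtlas 𝓘(ℝ, Fin (k + 1) → E) ∞ (HOTangent E Q k) :=
  IsManifold.subset_maximalAtlas (mem_atlas_iff.2 ⟨e, he, rfl⟩)

theorem natChart_apply (he : e ∈ atlas E Q) (x : HOTangent E Q k) :
    natChart k e he x = coord e x := rfl

theorem mem_natChart_source (he : e ∈ atlas E Q) {x : HOTangent E Q k} :
    x ∈ (natChart k e he).source ↔ x.proj ∈ e.source := Iff.rfl

theorem natChart_lift (he : e ∈ atlas E Q) {γ : ℝ → Q} {t : ℝ} (hγ : SmoothNear E γ t)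
    (ht : γ t ∈ e.source) :
    natChart k e he (lift k γ t) = fun j : Fin (k + 1) => iteratedDeriv j (e ∘ γ) t :=
  coord_lift he hγ ht

theorem contMDiff_proj :
    ContMDiff 𝓘(ℝ, Fin (k + 1) → E) 𝓘(ℝ, E) ∞ (proj : HOTangent E Q k → Q) := by
  intro x
  set e := chartAt E x.proj
  have he : e ∈ atlas E Q := chart_mem_atlas E x.proj
  have hx : x ∈ (natChart k e he).source := mem_chart_source E x.proj
  have h1 : ContMDiffAt 𝓘(ℝ, Fin (k + 1) → E) 𝓘(ℝ, E) ∞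
      (fun y => natChart k e he y 0) x :=
    (contMDiffAt_pi_space.1 (contMDiffAt_of_mem_maximalAtlas (natChart_mem_maximalAtlas he) hx)) 0
  have h2 : ContMDiffAt 𝓘(ℝ, E) 𝓘(ℝ, E) ∞ e.symm (natChart k e he x 0) :=
    contMDiffAt_symm_of_mem_maximalAtlas (IsManifold.subset_maximalAtlas he)
      (by rw [natChart_apply, coord_zero]; exact e.map_source hx)
  refine (h2.comp x h1).congr_of_eventuallyEq ?_
  filter_upwards [(natChart k e he).open_source.mem_nhds hx] with y hy
  have hy' : y.proj ∈ e.source := hy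
  simp [natChart_apply, coord_zero, e.left_inv hy']

theorem contMDiffAt_lift {γ : ℝ → Q} {t : ℝ} (hγ : SmoothNear E γ t) :
    ContMDiffAt 𝓘(ℝ, ℝ) 𝓘(ℝ, Fin (k + 1) → E) ∞ (lift (E := E) k γ) t := by
  set e := chartAt E (γ t)
  have he : e ∈ atlas E Q := chart_mem_atlas E (γ t)
  have ht : γ t ∈ e.source := mem_chart_source E (γ t)
  have h1 : ContDiffAt ℝ ∞ (fun s => fun j : Fin (k + 1) => iteratedDeriv j (e ∘ γ) s) t :=
    contDiffAt_pi.2 fun j => contDiffAt_iteratedDeriv (hγ.contDiffAt he ht).self_of_nhds j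
  have h2 : ContMDiffAt 𝓘(ℝ, Fin (k + 1) → E) 𝓘(ℝ, Fin (k + 1) → E) ∞ (natChart k e he).symm
      (fun j : Fin (k + 1) => iteratedDeriv j (e ∘ γ) t) := by
    refine contMDiffAt_symm_of_mem_maximalAtlas (natChart_mem_maximalAtlas he) ?_
    rw [← natChart_lift he hγ ht]
    exact (natChart k e he).map_source (by simpa [mem_natChart_source] using ht)
  exact (h2.comp t h1.contMDiffAt).congr_of_eventuallyEq (lift_eventuallyEq he hγ ht)

/-- The coordinates of a lift are successive derivatives, so differentiating in time moves each of
them one place up. This is why the immersion is linear in natural coordinates. -/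
theorem tangentCoord_velocity_lift (he : e ∈ atlas E Q) {γ : ℝ → Q} {t : ℝ}
    (hγ : SmoothNear E γ t) (ht : γ t ∈ e.source) :
    tangentCoord (natChart k e he) (velocity 𝓘(ℝ, Fin (k + 1) → E) (lift (E := E) k γ) t) =
      immersionCoord E k (natChart (k + 1) e he (lift (k + 1) γ t)) := by
  rw [tangentCoord_velocity (natChart_mem_maximalAtlas he)
    ((contMDiffAt_lift hγ).mdifferentiableAt (by simp)) (by simpa [mem_natChart_source] using ht),
    natChart_lift he hγ ht, natChart_lift he hγ ht, immersionCoord_apply]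
  refine Prod.ext rfl ?_
  have hev : natChart k e he ∘ lift k γ =ᶠ[𝓝 t]
      fun s => fun j : Fin (k + 1) => iteratedDeriv j (e ∘ γ) s := by
    filter_upwards [hγ.eventually_mem ht, eventually_eventually_nhds.2 hγ] with s hs hs'
    exact natChart_lift he hs' hs
  rw [hev.deriv_eq]
  refine HasDerivAt.deriv (hasDerivAt_pi.2 fun j => ?_)
  simp only [Fin.val_succ, iteratedDeriv_succ]
  exact ((contDiffAt_iteratedDeriv (hγ.contDiffAt he ht).self_of_nhds j).differentiableAt
    (by simp)).hasDerivAt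

theorem canonicalImmersion_mk (γ : CurveAtZero E Q) :
    canonicalImmersion (mk (k + 1) γ) = velocity 𝓘(ℝ, Fin (k + 1) → E) (lift (E := E) k γ.1) 0 :=
  rfl

theorem lift_zero (γ : CurveAtZero E Q) : lift k γ.1 0 = mk k γ := by
  unfold lift
  rw [dif_pos γ.2]
  simp

@[simp] theorem proj_canonicalImmersion (y : HOTangent E Q (k + 1)) :
    y.canonicalImmersion.proj.proj = y.proj := by
  conv_lhs => rw [← mk_rep y, canonicalImmersion_mk]
  exact proj_lift _ _

theorem tangentCoord_canonicalImmersion (he : e ∈ atlas E Q) {y : HOTangent E Q (k + 1)}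
    (hy : y.proj ∈ e.source) :
    tangentCoord (natChart k e he) y.canonicalImmersion =
      immersionCoord E k (natChart (k + 1) e he y) := by
  have hy' : y.rep.1 0 ∈ e.source := hy
  rw [← mk_rep y, canonicalImmersion_mk, tangentCoord_velocity_lift he y.rep.2 hy', lift_zero]

/-- The truncation recovers every coordinate but the last, and the shift recovers the last.
Injectivity identifies the point `y` that appears in the description of N_L. -/
theorem canonicalImmersion_injective :
    Function.Injective (canonicalImmersion : HOTangent E Q (k + 1) → _) := by
  intro y y' h
  have hp : y.proj = y'.proj := by rw [← proj_canonicalImmersion, h, proj_canonicalImmersion]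
  have he : chartAt E y.proj ∈ atlas E Q := chart_mem_atlas E y.proj
  have hy : y.proj ∈ (chartAt E y.proj).source := mem_chart_source E y.proj
  have hy' : y'.proj ∈ (chartAt E y.proj).source := hp ▸ hy
  refine (natChart (k + 1) (chartAt E y.proj) he).injOn hy hy' (immersionCoord_injective ?_)
  rw [← tangentCoord_canonicalImmersion he hy, ← tangentCoord_canonicalImmersion he hy', h]

/-- The immersion is defined by a velocity at time 0. Comparing natural coordinates carries the
formula to every time without differentiating a translated curve. -/
theorem canonicalImmersion_lift {γ : ℝ → Q} {t : ℝ} (hγ : SmoothNear E γ t) :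
    (lift (k + 1) γ t).canonicalImmersion =
      velocity 𝓘(ℝ, Fin (k + 1) → E) (lift (E := E) k γ) t := by
  have he : chartAt E (γ t) ∈ atlas E Q := chart_mem_atlas E (γ t)
  have ht : γ t ∈ (chartAt E (γ t)).source := mem_chart_source E (γ t)
  refine tangentCoord_inj (natChart_mem_maximalAtlas he) ?_ ?_ ?_
  · rw [mem_natChart_source, proj_canonicalImmersion, proj_lift]
    exact ht
  · rw [mem_natChart_source]
    change (lift k γ t).proj ∈ _
    rw [proj_lift]
    exact ht
  · rw [tangentCoord_velocity_lift he hγ ht,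
      tangentCoord_canonicalImmersion he (by rwa [proj_lift])]

theorem contMDiff_canonicalImmersion :
    ContMDiff 𝓘(ℝ, Fin (k + 1 + 1) → E) 𝓘(ℝ, Fin (k + 1) → E).tangent ∞
      (canonicalImmersion : HOTangent E Q (k + 1) → _) := by
  intro y
  rw [contMDiffAt_tangentBundle_iff]
  have he : chartAt E y.proj ∈ atlas E Q := chart_mem_atlas E y.proj
  have hy : y ∈ (natChart (k + 1) (chartAt E y.proj) he).source := mem_chart_source E y.proj
  -- A point and its image under the immersion lie over the same point of Q, so their preferred
  -- charts come from the same chart of Q.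
  have hc : chartAt (Fin (k + 1) → E) y.canonicalImmersion.proj =
      natChart k (chartAt E y.proj) he := by
    change natChart k (chartAt E y.canonicalImmersion.proj.proj) (chart_mem_atlas E _) = _
    simp only [proj_canonicalImmersion]
  have hev : ∀ᶠ z in 𝓝 y, tangentCoord (natChart k (chartAt E y.proj) he) z.canonicalImmersion =
      immersionCoord E k (natChart (k + 1) (chartAt E y.proj) he z) := by
    filter_upwards [(natChart (k + 1) (chartAt E y.proj) he).open_source.mem_nhds hy] with z hz
    exact tangentCoord_canonicalImmersion he hz
  have h0 := contMDiffAt_of_mem_maximalAtlas (natChart_mem_maximalAtlas (k := k + 1) he) hy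
  constructor
  · have h1 : ContMDiffAt 𝓘(ℝ, Fin (k + 1 + 1) → E) 𝓘(ℝ, Fin (k + 1) → E) ∞
        (fun z => truncate E k (natChart (k + 1) (chartAt E y.proj) he z)) y :=
      (truncate E k).contMDiff.contMDiffAt.comp y h0
    have h2 : ContMDiffAt 𝓘(ℝ, Fin (k + 1) → E) 𝓘(ℝ, Fin (k + 1) → E) ∞
        (natChart k (chartAt E y.proj) he).symm
        (truncate E k (natChart (k + 1) (chartAt E y.proj) he y)) := by
      refine contMDiffAt_symm_of_mem_maximalAtlas (natChart_mem_maximalAtlas he) ?_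
      have := congrArg Prod.fst hev.self_of_nhds
      change natChart k (chartAt E y.proj) he y.canonicalImmersion.proj = _ at this
      change (immersionCoord E k (natChart (k + 1) (chartAt E y.proj) he y)).1 ∈ _
      rw [← this]
      refine (natChart k (chartAt E y.proj) he).map_source ?_
      rw [mem_natChart_source, proj_canonicalImmersion]
      exact hy
    refine (h2.comp y h1).congr_of_eventuallyEq ?_
    filter_upwards [hev, (natChart (k + 1) (chartAt E y.proj) he).open_source.mem_nhds hy]
      with z hz hz'
    have := congrArg Prod.fst hz
    change natChart k (chartAt E y.proj) he z.canonicalImmersion.proj =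
      truncate E k (natChart (k + 1) (chartAt E y.proj) he z) at this
    rw [Function.comp_apply, ← this, (natChart k (chartAt E y.proj) he).left_inv]
    rw [mem_natChart_source, proj_canonicalImmersion]
    exact hz'
  · rw [hc]
    have h1 : ContMDiffAt 𝓘(ℝ, Fin (k + 1 + 1) → E) 𝓘(ℝ, Fin (k + 1) → E) ∞
        (fun z => shift E k (natChart (k + 1) (chartAt E y.proj) he z)) y :=
      (shift E k).contMDiff.contMDiffAt.comp y h0
    refine h1.congr_of_eventuallyEq ?_
    filter_upwards [hev] with z hz
    exact congrArg Prod.snd hz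

/-- The derivative of the canonical immersion. -/
def canonicalImmersionDeriv (y : HOTangent E Q (k + 1)) :
    (Fin (k + 1 + 1) → E) →L[ℝ] (Fin (k + 1) → E) × (Fin (k + 1) → E) :=
  mfderiv 𝓘(ℝ, Fin (k + 1 + 1) → E) 𝓘(ℝ, Fin (k + 1) → E).tangent canonicalImmersion y

/-- The chain rule applied to the coordinate expression of the immersion, where the linear map
`immersionCoord` is its own derivative. -/
theorem tangentCoordDeriv_comp_canonicalImmersionDeriv (he : e ∈ atlas E Q)
    {y : HOTangent E Q (k + 1)} (hy : y.proj ∈ e.source) :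
    tangentCoordDeriv (natChart k e he) y.canonicalImmersion ∘L canonicalImmersionDeriv y =
      immersionCoord E k ∘L chartDeriv (natChart (k + 1) e he) y := by
  have h1 := hasMFDerivAt_tangentCoord (natChart_mem_maximalAtlas (k := k) he)
    (z := y.canonicalImmersion) (by rwa [mem_natChart_source, proj_canonicalImmersion])
  have h2 := ((contMDiff_canonicalImmersion (k := k) y).mdifferentiableAt (by simp)).hasMFDerivAt
  have h3 := (mdifferentiable_of_mem_maximalAtlas (natChart_mem_maximalAtlas (k := k + 1)
    he)).mdifferentiableAt hy
  have h4 := (immersionCoord E k).hasMFDerivAt.comp y h3.hasMFDerivAt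
  have hev : tangentCoord (natChart k e he) ∘ canonicalImmersion =ᶠ[𝓝 y]
      immersionCoord E k ∘ natChart (k + 1) e he := by
    filter_upwards [(natChart (k + 1) e he).open_source.mem_nhds hy] with z hz
    exact tangentCoord_canonicalImmersion he hz
  have h5 := (h1.mdifferentiableAt.hasMFDerivAt.comp y h2).mfderiv
  rw [hev.mfderiv_eq, h4.mfderiv] at h5
  exact h5.symm

end HOTangent

end Immersion

/-! ### The dynamics in natural coordinates -/

section DynamicsCoordinates

variable {E : Type*} [NormedAddCommGroup E] [NormedSpace ℝ E]
  {Q : Type*} [TopologicalSpace Q] [ChartedSpace E Q] [IsManifold 𝓘(ℝ, E) ∞ Q]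
  {k : ℕ} {e : OpenPartialHomeomorph Q E} {L : HOTangent E Q (k + 1) → ℝ}

open HOTangent

/-- The velocity depends only on the germ of the curve. -/
theorem velocity_congr {F H : Type*} [NormedAddCommGroup F] [NormedSpace ℝ F] [TopologicalSpace H]
    (J : ModelWithCorners ℝ F H) {M : Type*} [TopologicalSpace M] [ChartedSpace H M]
    {x x' : ℝ → M} {t : ℝ} (h : x =ᶠ[𝓝 t] x') : velocity J x t = velocity J x' t := by
  obtain ⟨v, hv⟩ : ∃ v : F, v = mfderiv 𝓘(ℝ, ℝ) J x t (1 : ℝ) := ⟨_, rfl⟩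
  have hv' : v = mfderiv 𝓘(ℝ, ℝ) J x' t (1 : ℝ) :=
    hv.trans (congrArg (fun A : ℝ →L[ℝ] F => A 1) h.mfderiv_eq)
  have h1 : velocity J x t = ⟨x t, v⟩ := by rw [hv]; rfl
  have h2 : velocity J x' t = ⟨x' t, v⟩ := by rw [hv']; rfl
  rw [h1, h2]
  exact congrArg (fun y => (⟨y, v⟩ : TangentBundle J M)) h.self_of_nhds

theorem contDiffAt_comp_natChart_symm (he : e ∈ atlas E Q)
    (hL : ContMDiff 𝓘(ℝ, Fin (k + 1 + 1) → E) 𝓘(ℝ, ℝ) ∞ L) {y : HOTangent E Q (k + 1)}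
    (hy : y.proj ∈ e.source) :
    ContDiffAt ℝ ∞ (L ∘ (natChart (k + 1) e he).symm) (natChart (k + 1) e he y) := by
  have h1 := contMDiffAt_symm_of_mem_maximalAtlas (natChart_mem_maximalAtlas (k := k + 1) he)
    ((natChart (k + 1) e he).map_source hy)
  exact (hL.contMDiffAt.comp _ h1).contDiffAt

theorem mfderiv_eq_comp_chartDeriv (he : e ∈ atlas E Q)
    (hL : ContMDiff 𝓘(ℝ, Fin (k + 1 + 1) → E) 𝓘(ℝ, ℝ) ∞ L) {y : HOTangent E Q (k + 1)}
    (hy : y.proj ∈ e.source) :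
    (mfderiv 𝓘(ℝ, Fin (k + 1 + 1) → E) 𝓘(ℝ, ℝ) L y : (Fin (k + 1 + 1) → E) →L[ℝ] ℝ) =
      fderiv ℝ (L ∘ (natChart (k + 1) e he).symm) (natChart (k + 1) e he y) ∘L
        chartDeriv (natChart (k + 1) e he) y := by
  have h1 := ((contDiffAt_comp_natChart_symm he hL hy).differentiableAt
    (by simp)).hasFDerivAt.hasMFDerivAt
  have h2 := (mdifferentiable_of_mem_maximalAtlas (natChart_mem_maximalAtlas (k := k + 1)
    he)).mdifferentiableAt hy
  refine ((h1.comp y h2.hasMFDerivAt).congr_of_eventuallyEq ?_).mfderiv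
  filter_upwards [(natChart (k + 1) e he).open_source.mem_nhds hy] with z hz
  simp [(natChart (k + 1) e he).left_inv hz]

/-- The equation `j* μ = dL` for covectors given in natural coordinates. -/
theorem mk_mem_lagrangianSubmanifold_iff (he : e ∈ atlas E Q)
    (hL : ContMDiff 𝓘(ℝ, Fin (k + 1 + 1) → E) 𝓘(ℝ, ℝ) ∞ L)
    {z : TangentBundle 𝓘(ℝ, Fin (k + 1) → E) (HOTangent E Q k)} (hz : z.proj.proj ∈ e.source)
    (A : (Fin (k + 1) → E) × (Fin (k + 1) → E) →L[ℝ] ℝ) :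
    (⟨z, A ∘L tangentCoordDeriv (natChart k e he) z⟩ :
      CotangentBundle 𝓘(ℝ, Fin (k + 1) → E).tangent
        (TangentBundle 𝓘(ℝ, Fin (k + 1) → E) (HOTangent E Q k))) ∈ lagrangianSubmanifold L ↔
    ∃ y : HOTangent E Q (k + 1), z = y.canonicalImmersion ∧ A ∘L immersionCoord E k =
      fderiv ℝ (L ∘ (natChart (k + 1) e he).symm) (natChart (k + 1) e he y) := by
  -- In coordinates both sides end in the derivative of the chart at `y`, which is invertible and
  -- cancels.
  have key : ∀ y : HOTangent E Q (k + 1), y.proj ∈ e.source →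
      ((A ∘L tangentCoordDeriv (natChart k e he) y.canonicalImmersion) ∘L
          canonicalImmersionDeriv y =
        (mfderiv 𝓘(ℝ, Fin (k + 1 + 1) → E) 𝓘(ℝ, ℝ) L y : (Fin (k + 1 + 1) → E) →L[ℝ] ℝ) ↔
      A ∘L immersionCoord E k =
        fderiv ℝ (L ∘ (natChart (k + 1) e he).symm) (natChart (k + 1) e he y)) := by
    intro y hy
    rw [mfderiv_eq_comp_chartDeriv he hL hy, ContinuousLinearMap.comp_assoc,
      tangentCoordDeriv_comp_canonicalImmersionDeriv he hy, ← ContinuousLinearMap.comp_assoc]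
    constructor
    · intro h
      ext v
      have h1 := congrArg (fun B : (Fin (k + 1 + 1) → E) →L[ℝ] ℝ =>
        B (chartDerivSymm (natChart (k + 1) e he) y v)) h
      simpa [chartDeriv_chartDerivSymm (natChart_mem_maximalAtlas he) hy] using h1
    · intro h
      rw [h]
  constructor
  · rintro ⟨y, p, h1, h2⟩
    obtain rfl : z = y.canonicalImmersion := congrArg TotalSpace.proj h1
    have hp : (A ∘L tangentCoordDeriv (natChart k e he) y.canonicalImmersion) = p := by
      injection h1
    subst hp
    exact ⟨y, rfl, (key y (by simpa using hz)).1 h2⟩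
  · rintro ⟨y, rfl, h⟩
    exact ⟨y, _, rfl, (key y (by simpa using hz)).2 h⟩

/-- The implicit differential equation `N_L` in natural coordinates. -/
theorem velocity_mem_dynamicsSubmanifold_iff (he : e ∈ atlas E Q)
    (hL : ContMDiff 𝓘(ℝ, Fin (k + 1 + 1) → E) 𝓘(ℝ, ℝ) ∞ L)
    {σ : ℝ → CotangentBundle 𝓘(ℝ, Fin (k + 1) → E) (HOTangent E Q k)} {t : ℝ}
    (hσ : ContMDiffAt 𝓘(ℝ, ℝ) (cotangentModel 𝓘(ℝ, Fin (k + 1) → E)) ∞ σ t)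
    (ht : (σ t).proj.proj ∈ e.source) :
    velocity (cotangentModel 𝓘(ℝ, Fin (k + 1) → E)) σ t ∈ dynamicsSubmanifold L ↔
    ∃ y : HOTangent E Q (k + 1),
      velocity 𝓘(ℝ, Fin (k + 1) → E) (fun s => (σ s).proj) t = y.canonicalImmersion ∧
      ((deriv (fun s => momentum (natChart k e he) (σ s)) t).coprod
        (momentum (natChart k e he) (σ t))) ∘L immersionCoord E k =
      fderiv ℝ (L ∘ (natChart (k + 1) e he).symm) (natChart (k + 1) e he y) := by
  rw [dynamicsSubmanifold, mem_preimage, tulczyjewAlpha_velocity (natChart_mem_maximalAtlas he) hσ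
    ht]
  exact mk_mem_lagrangianSubmanifold_iff he hL ht _

/-- Along a curve this is the identity between the projection after α and the tangent map of the
projection from the cotangent bundle to its base. -/
theorem proj_tulczyjewAlpha_velocity
    {σ : ℝ → CotangentBundle 𝓘(ℝ, Fin (k + 1) → E) (HOTangent E Q k)} {t : ℝ}
    (hσ : ContMDiffAt 𝓘(ℝ, ℝ) (cotangentModel 𝓘(ℝ, Fin (k + 1) → E)) ∞ σ t) :
    (tulczyjewAlpha (velocity (cotangentModel 𝓘(ℝ, Fin (k + 1) → E)) σ t)).proj =
      velocity 𝓘(ℝ, Fin (k + 1) → E) (fun s => (σ s).proj) t := by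
  rw [tulczyjewAlpha_velocity (chartAt_mem_maximalAtlas (σ t).proj) hσ (mem_chart_source _ _)]

/-- A curve in `T^{(k)}Q` whose velocities lie in the image of the canonical immersion is a
`k`-lift. -/
theorem eq_lift_of_velocity_mem_range {x : ℝ → HOTangent E Q k} {t : ℝ}
    (hx : ∀ᶠ s in 𝓝 t, ContMDiffAt 𝓘(ℝ, ℝ) 𝓘(ℝ, Fin (k + 1) → E) ∞ x s)
    (h : ∀ᶠ s in 𝓝 t, velocity 𝓘(ℝ, Fin (k + 1) → E) x s ∈
      range (canonicalImmersion : HOTangent E Q (k + 1) → _)) :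
    SmoothNear E (fun s => (x s).proj) t ∧ x t = lift k (fun s => (x s).proj) t := by
  have hγ : SmoothNear E (fun s => (x s).proj) t :=
    hx.mono fun s hs => contMDiff_proj.contMDiffAt.comp s hs
  refine ⟨hγ, ?_⟩
  set γ : ℝ → Q := fun s => (x s).proj
  set e := chartAt E (γ t)
  have he : e ∈ atlas E Q := chart_mem_atlas E (γ t)
  have ht : γ t ∈ e.source := mem_chart_source E (γ t)
  have hmem := hγ.eventually_mem ht
  -- Coordinate `j + 1` of `y` is read twice: as the derivative of coordinate `j` of `x`, from the
  -- shift, and as coordinate `j + 1` of `x`, from the truncation. This is possible only for `j <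
  -- k`; the derivative of the last coordinate of `x` is unconstrained.
  have hstep : ∀ᶠ s in 𝓝 t, ∀ j : Fin k, HasDerivAt
      (fun s => natChart k e he (x s) j.castSucc) (natChart k e he (x s) j.succ) s := by
    filter_upwards [hx, h, hmem] with s hs ⟨y, hy⟩ hms j
    have hsrc : x s ∈ (natChart k e he).source := hms
    have h1 := tangentCoord_velocity (natChart_mem_maximalAtlas he)
      (hs.mdifferentiableAt (by simp)) hsrc
    have hyp : y.proj = γ s := by
      rw [← proj_canonicalImmersion, hy]
      rfl
    rw [← hy, tangentCoord_canonicalImmersion he (by rwa [hyp]), immersionCoord_apply] at h1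
    have h2 : DifferentiableAt ℝ (natChart k e he ∘ x) s :=
      (((contMDiffAt_of_mem_maximalAtlas (natChart_mem_maximalAtlas he) hsrc).comp s
        hs).contDiffAt).differentiableAt (by simp)
    have h3 := (hasDerivAt_pi.1 h2.hasDerivAt) j.castSucc
    have h4 := congrFun (congrArg Prod.snd h1) j.castSucc
    have h5 := congrFun (congrArg Prod.fst h1) j.succ
    simp only at h4 h5
    rw [← h4, Fin.succ_castSucc, h5] at h3
    exact h3
  have hcoord : ∀ (n : ℕ) (hn : n < k + 1), (fun s => natChart k e he (x s) ⟨n, hn⟩) =ᶠ[𝓝 t]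
      iteratedDeriv n (e ∘ γ) := by
    intro n
    induction n with
    | zero =>
      intro hn
      refine Eventually.of_forall fun s => ?_
      rw [iteratedDeriv_zero]
      exact coord_zero e (x s)
    | succ n ih =>
      intro hn
      rw [iteratedDeriv_succ]
      filter_upwards [(ih (by omega)).deriv, hstep] with s hs hs'
      rw [← hs]
      exact (hs' ⟨n, by omega⟩).deriv.symm
  have hsrc : x t ∈ (natChart k e he).source := ht
  refine (natChart k e he).injOn hsrc ?_ ?_
  · rw [mem_natChart_source, proj_lift]
    exact ht
  · rw [natChart_lift he hγ ht]
    funext j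
    exact (hcoord j j.2).self_of_nhds

/-- The partial differentials of `L` along the lift of a curve, extended by zero. -/
def forceAlong (L : HOTangent E Q (k + 1) → ℝ) (e : OpenPartialHomeomorph Q E)
    (he : e ∈ atlas E Q) (γ : ℝ → Q) (n : ℕ) (s : ℝ) : E →L[ℝ] ℝ :=
  if h : n < k + 1 + 1 then partialDiff L e he ⟨n, h⟩ (lift (k + 1) γ s) else 0

theorem forceAlong_of_lt {γ : ℝ → Q} (he : e ∈ atlas E Q) {n : ℕ} (h : n < k + 1 + 1) (s : ℝ) :
    forceAlong L e he γ n s = fderiv ℝ (L ∘ (natChart (k + 1) e he).symm)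
      (natChart (k + 1) e he (lift (k + 1) γ s)) ∘L
        ContinuousLinearMap.single ℝ (fun _ : Fin (k + 1 + 1) => E) ⟨n, h⟩ :=
  dif_pos h

theorem contDiffAt_forceAlong (he : e ∈ atlas E Q)
    (hL : ContMDiff 𝓘(ℝ, Fin (k + 1 + 1) → E) 𝓘(ℝ, ℝ) ∞ L) {γ : ℝ → Q} {t : ℝ}
    (hγ : SmoothNear E γ t) (ht : γ t ∈ e.source) (n : ℕ) :
    ContDiffAt ℝ ∞ (forceAlong L e he γ n) t := by
  by_cases h : n < k + 1 + 1
  · have hs : (lift (E := E) (k + 1) γ t).proj ∈ e.source := by rwa [proj_lift]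
    have h1 : ContDiffAt ℝ ∞ (fun s => natChart (k + 1) e he (lift (k + 1) γ s)) t :=
      ((contMDiffAt_of_mem_maximalAtlas (natChart_mem_maximalAtlas he) hs).comp t
        (contMDiffAt_lift hγ)).contDiffAt
    have h2 := ((contDiffAt_comp_natChart_symm he hL hs).fderiv_right (m := ∞)
      (by simp)).comp t h1
    refine (h2.clm_comp (contDiffAt_const (c := ContinuousLinearMap.single ℝ
      (fun _ : Fin (k + 1 + 1) => E) ⟨n, h⟩))).congr_of_eventuallyEq ?_
    exact Eventually.of_forall fun s => forceAlong_of_lt he h s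
  · have : forceAlong L e he γ n = fun _ => 0 := funext fun s => dif_neg h
    rw [this]
    exact contDiffAt_const

theorem eventually_contDiffAt_forceAlong (he : e ∈ atlas E Q)
    (hL : ContMDiff 𝓘(ℝ, Fin (k + 1 + 1) → E) 𝓘(ℝ, ℝ) ∞ L) {γ : ℝ → Q} {t : ℝ}
    (hγ : SmoothNear E γ t) (ht : γ t ∈ e.source) :
    ∀ᶠ s in 𝓝 t, ∀ n, ContDiffAt ℝ ∞ (forceAlong L e he γ n) s := by
  filter_upwards [hγ.eventually_mem ht, eventually_eventually_nhds.2 hγ] with s hs hs' n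
  exact contDiffAt_forceAlong he hL hs' hs n

/-- The left-hand side of the Euler-Lagrange equations is the momentum of index `-1`. -/
theorem ostrogradsky_forceAlong_zero (he : e ∈ atlas E Q) (γ : ℝ → Q) (t : ℝ) :
    ostrogradsky (forceAlong L e he γ) (k + 1 + 1) 0 t = ∑ j : Fin (k + 1 + 1),
      (-1 : ℝ) ^ (j : ℕ) •
        iteratedDeriv j (fun s => partialDiff L e he j (lift (k + 1) γ s)) t := by
  rw [ostrogradsky, Nat.sub_zero, Finset.sum_range]
  refine Finset.sum_congr rfl fun j _ => ?_
  have : forceAlong L e he γ (0 + j) = fun s => partialDiff L e he j (lift (k + 1) γ s) := by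
    funext s
    rw [zero_add]
    exact dif_pos j.2
  rw [this]

/-- The implicit differential equation `N_L` over a lift, in terms of the components of the
momentum. -/
theorem velocity_mem_dynamicsSubmanifold_iff_of_lift (he : e ∈ atlas E Q)
    (hL : ContMDiff 𝓘(ℝ, Fin (k + 1 + 1) → E) 𝓘(ℝ, ℝ) ∞ L) {γ : ℝ → Q} {t : ℝ}
    (hγ : SmoothNear E γ t) (ht : γ t ∈ e.source)
    {σ : ℝ → CotangentBundle 𝓘(ℝ, Fin (k + 1) → E) (HOTangent E Q k)}
    (hσ : ContMDiffAt 𝓘(ℝ, ℝ) (cotangentModel 𝓘(ℝ, Fin (k + 1) → E)) ∞ σ t)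
    (hσγ : (fun s => (σ s).proj) =ᶠ[𝓝 t] lift k γ) :
    velocity (cotangentModel 𝓘(ℝ, Fin (k + 1) → E)) σ t ∈ dynamicsSubmanifold L ↔
    ∀ n < k + 1 + 1, momentumComponent E k n (momentum (natChart k e he) (σ t)) +
      deriv (fun s => momentumComponent E k (n + 1) (momentum (natChart k e he) (σ s))) t =
        forceAlong L e he γ n t := by
  have ht' : (σ t).proj.proj ∈ e.source := by
    have := hσγ.self_of_nhds
    simp only at this
    rwa [this, proj_lift]
  have hvel : velocity 𝓘(ℝ, Fin (k + 1) → E) (fun s => (σ s).proj) t =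
      (lift (k + 1) γ t).canonicalImmersion := by
    rw [canonicalImmersion_lift hγ]
    exact velocity_congr _ hσγ
  have hd : HasDerivAt (fun s => momentum (natChart k e he) (σ s))
      (deriv (fun s => momentum (natChart k e he) (σ s)) t) t :=
    (((contMDiffAt_cotangentBundle_iff_of_mem_maximalAtlas (natChart_mem_maximalAtlas he)
      ht').1 hσ).2.differentiableAt (by simp)).hasDerivAt
  have hcomp : ∀ n, deriv (fun s => momentumComponent E k n (momentum (natChart k e he) (σ s))) t =
      momentumComponent E k n (deriv (fun s => momentum (natChart k e he) (σ s)) t) :=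
    fun n => ((momentumComponent E k n).hasFDerivAt.comp_hasDerivAt t hd).deriv
  rw [velocity_mem_dynamicsSubmanifold_iff he hL hσ ht']
  simp only [hvel, coprod_comp_immersionCoord_eq_iff, hcomp]
  constructor
  · rintro ⟨y, hy, h⟩ n hn
    obtain rfl := canonicalImmersion_injective hy
    rw [h n hn, forceAlong_of_lt he hn]
  · intro h
    refine ⟨_, rfl, fun n hn => ?_⟩
    rw [h n hn, forceAlong_of_lt he hn]

end DynamicsCoordinates

/-! ### Jacobi-Ostrogradsky momenta and the construction of solutions -/

section Solutions

variable {E : Type*} [NormedAddCommGroup E] [NormedSpace ℝ E]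
  {Q : Type*} [TopologicalSpace Q] [ChartedSpace E Q] [IsManifold 𝓘(ℝ, E) ∞ Q]
  {k : ℕ} {e : OpenPartialHomeomorph Q E} {L : HOTangent E Q (k + 1) → ℝ} {γ : ℝ → Q} {t : ℝ}
  {I : Set ℝ}

open HOTangent

/-- The Jacobi-Ostrogradsky momentum along a curve. -/
def momentumAlong (L : HOTangent E Q (k + 1) → ℝ) (e : OpenPartialHomeomorph Q E)
    (he : e ∈ atlas E Q) (γ : ℝ → Q) (s : ℝ) : (Fin (k + 1) → E) →L[ℝ] ℝ :=
  ∑ j : Fin (k + 1), ostrogradsky (forceAlong L e he γ) (k + 1 + 1) (j + 1) s ∘L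
    ContinuousLinearMap.proj (R := ℝ) (φ := fun _ : Fin (k + 1) => E) j

/-- The range includes the index `n = k + 1`, one beyond the actual components: there the left side
vanishes by convention and the right side is an empty sum. -/
theorem momentumComponent_momentumAlong (he : e ∈ atlas E Q) {n : ℕ} (hn : n < k + 1 + 1) (s : ℝ) :
    momentumComponent E k (n + 1) (momentumAlong L e he γ s) =
      ostrogradsky (forceAlong L e he γ) (k + 1 + 1) (n + 1) s := by
  rcases Nat.lt_succ_iff_lt_or_eq.1 hn with h | rfl
  · exact momentumComponent_sum
      (fun m => ostrogradsky (forceAlong L e he γ) (k + 1 + 1) m s) h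
  · rw [momentumComponent_of_lt (by omega), ostrogradsky_self]
    rfl

theorem contDiffAt_momentumAlong (he : e ∈ atlas E Q)
    (hL : ContMDiff 𝓘(ℝ, Fin (k + 1 + 1) → E) 𝓘(ℝ, ℝ) ∞ L) (hγ : SmoothNear E γ t)
    (ht : γ t ∈ e.source) : ContDiffAt ℝ ∞ (momentumAlong L e he γ) t :=
  ContDiffAt.sum fun j _ => (contDiffAt_ostrogradsky
    (contDiffAt_forceAlong he hL hγ ht) (k + 1 + 1) (j + 1)).clm_comp contDiffAt_const

/-- Solutions of `N_L` over the lift of `γ` have the Jacobi-Ostrogradsky momenta, and `γ` satisfies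
the Euler-Lagrange equations. -/
theorem momentum_eq_momentumAlong (he : e ∈ atlas E Q)
    (hL : ContMDiff 𝓘(ℝ, Fin (k + 1 + 1) → E) 𝓘(ℝ, ℝ) ∞ L) (hγ : SmoothNear E γ t)
    (ht : γ t ∈ e.source) {σ : ℝ → CotangentBundle 𝓘(ℝ, Fin (k + 1) → E) (HOTangent E Q k)}
    (hσ : ∀ᶠ s in 𝓝 t, ContMDiffAt 𝓘(ℝ, ℝ) (cotangentModel 𝓘(ℝ, Fin (k + 1) → E)) ∞ σ s)
    (hσγ : (fun s => (σ s).proj) =ᶠ[𝓝 t] lift k γ)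
    (hN : ∀ᶠ s in 𝓝 t,
      velocity (cotangentModel 𝓘(ℝ, Fin (k + 1) → E)) σ s ∈ dynamicsSubmanifold L) :
    ostrogradsky (forceAlong L e he γ) (k + 1 + 1) 0 t = 0 ∧
      momentum (natChart k e he) (σ t) = momentumAlong L e he γ t := by
  have hrec : ∀ᶠ s in 𝓝 t, ∀ n < k + 1 + 1,
      momentumComponent E k n (momentum (natChart k e he) (σ s)) +
      deriv (fun s => momentumComponent E k (n + 1) (momentum (natChart k e he) (σ s))) s =
        forceAlong L e he γ n s := by
    filter_upwards [hσ, hσγ.eventuallyEq_nhds, hN, eventually_eventually_nhds.2 hγ,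
      hγ.eventually_mem ht] with s h1 h2 h3 h4 h5
    exact (velocity_mem_dynamicsSubmanifold_iff_of_lift he hL h4 h5 h1 h2).1 h3
  -- The components satisfy the recursion with terminal value zero at `k + 2`, so they are the
  -- Ostrogradsky sums. For `m = 0` the component is zero by definition, and this case is the
  -- Euler–Lagrange equation.
  have key : ∀ m ≤ k + 1 + 1, momentumComponent E k m (momentum (natChart k e he) (σ t)) =
      ostrogradsky (forceAlong L e he γ) (k + 1 + 1) m t := fun m hm =>
    (eventuallyEq_ostrogradsky
      (p := fun n s => momentumComponent E k n (momentum (natChart k e he) (σ s)))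
      (eventually_contDiffAt_forceAlong he hL hγ ht) hrec
      (Eventually.of_forall fun s => momentumComponent_of_lt (by omega) _) hm).self_of_nhds
  refine ⟨(key 0 (by omega)).symm, clm_ext_momentumComponent fun n => ?_⟩
  cases n with
  | zero => rfl
  | succ n =>
    by_cases hn : n < k + 1 + 1
    · rw [key (n + 1) (by omega), momentumComponent_momentumAlong he hn]
    · rw [momentumComponent_of_lt (by omega), momentumComponent_of_lt (by omega)]

/-- The curve in `T*T^{(k)}Q` over the lift of `γ` with the Jacobi-Ostrogradsky momenta. -/
def phaseCurve (L : HOTangent E Q (k + 1) → ℝ) (e : OpenPartialHomeomorph Q E)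
    (he : e ∈ atlas E Q) (γ : ℝ → Q) (s : ℝ) :
    CotangentBundle 𝓘(ℝ, Fin (k + 1) → E) (HOTangent E Q k) :=
  ofMomentum (natChart k e he) (lift k γ s) (momentumAlong L e he γ s)

theorem momentum_phaseCurve (he : e ∈ atlas E Q) (ht : γ t ∈ e.source) :
    momentum (natChart k e he) (phaseCurve L e he γ t) = momentumAlong L e he γ t :=
  momentum_ofMomentum (natChart_mem_maximalAtlas he)
    (by rwa [mem_natChart_source, proj_lift]) _

theorem contMDiffAt_phaseCurve (he : e ∈ atlas E Q)
    (hL : ContMDiff 𝓘(ℝ, Fin (k + 1 + 1) → E) 𝓘(ℝ, ℝ) ∞ L) (hγ : SmoothNear E γ t)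
    (ht : γ t ∈ e.source) :
    ContMDiffAt 𝓘(ℝ, ℝ) (cotangentModel 𝓘(ℝ, Fin (k + 1) → E)) ∞ (phaseCurve L e he γ) t := by
  have hsrc : (phaseCurve L e he γ t).proj ∈ (natChart k e he).source := by
    change (lift k γ t).proj ∈ e.source
    rwa [proj_lift]
  rw [contMDiffAt_cotangentBundle_iff_of_mem_maximalAtlas (natChart_mem_maximalAtlas he) hsrc]
  refine ⟨contMDiffAt_lift hγ, (contDiffAt_momentumAlong he hL hγ ht).congr_of_eventuallyEq ?_⟩
  filter_upwards [hγ.eventually_mem ht] with s hs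
  exact momentum_phaseCurve he hs

/-- The Ostrogradsky sums satisfy the recursion for every curve. The Euler–Lagrange equation enters
only at `n = 0`, where the recursion calls for the sum of index 0 but the component of the covector
is zero. -/
theorem velocity_phaseCurve_mem (he : e ∈ atlas E Q)
    (hL : ContMDiff 𝓘(ℝ, Fin (k + 1 + 1) → E) 𝓘(ℝ, ℝ) ∞ L) (hγ : SmoothNear E γ t)
    (ht : γ t ∈ e.source) (h0 : ostrogradsky (forceAlong L e he γ) (k + 1 + 1) 0 t = 0) :
    velocity (cotangentModel 𝓘(ℝ, Fin (k + 1) → E)) (phaseCurve L e he γ) t ∈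
      dynamicsSubmanifold L := by
  rw [velocity_mem_dynamicsSubmanifold_iff_of_lift he hL hγ ht
    (contMDiffAt_phaseCurve he hL hγ ht) (Eventually.of_forall fun _ => rfl)]
  intro n hn
  have h1 : (fun s => momentumComponent E k (n + 1)
      (momentum (natChart k e he) (phaseCurve L e he γ s))) =ᶠ[𝓝 t]
      ostrogradsky (forceAlong L e he γ) (k + 1 + 1) (n + 1) := by
    filter_upwards [hγ.eventually_mem ht] with s hs
    rw [momentum_phaseCurve he hs, momentumComponent_momentumAlong he hn]
  rw [h1.deriv_eq, ← ostrogradsky_add_deriv (contDiffAt_forceAlong he hL hγ ht) hn,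
    momentum_phaseCurve he ht]
  congr 1
  cases n with
  | zero => rw [momentumComponent_zero, h0]
  | succ n => rw [momentumComponent_momentumAlong he (by omega)]

/-- The base curve of a solution of `N_L` is a lift. -/
theorem proj_eq_lift_of_velocity_mem (hI : IsOpen I)
    {σ : ℝ → CotangentBundle 𝓘(ℝ, Fin (k + 1) → E) (HOTangent E Q k)}
    (hσ : ContMDiffOn 𝓘(ℝ, ℝ) (cotangentModel 𝓘(ℝ, Fin (k + 1) → E)) ∞ σ I)
    (hN : ∀ t ∈ I, velocity (cotangentModel 𝓘(ℝ, Fin (k + 1) → E)) σ t ∈ dynamicsSubmanifold L)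
    (ht : t ∈ I) :
    SmoothNear E (fun s => (σ s).proj.proj) t ∧
      (σ t).proj = lift k (fun s => (σ s).proj.proj) t := by
  have hσ' : ∀ s ∈ I, ContMDiffAt 𝓘(ℝ, ℝ) (cotangentModel 𝓘(ℝ, Fin (k + 1) → E)) ∞ σ s :=
    fun s hs => hσ.contMDiffAt (hI.mem_nhds hs)
  refine eq_lift_of_velocity_mem_range (x := fun s => (σ s).proj) ?_ ?_
  · filter_upwards [hI.mem_nhds ht] with s hs
    exact (contMDiffAt_cotangentBundle_iff.1 (hσ' s hs)).1
  · filter_upwards [hI.mem_nhds ht] with s hs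
    obtain ⟨y, p, h, -⟩ := hN s hs
    refine ⟨y, ?_⟩
    rw [← proj_tulczyjewAlpha_velocity (hσ' s hs), h]

/-- Over T^{(k)}Q, α keeps the foot point, and the immersion sends the higher lift of γ to a
velocity of its `k`-lift. Projecting both to T^{(k)}Q compares σ with the lift. -/
theorem proj_eq_lift_of_proj_eq (hI : IsOpen I) (hγ : ContMDiffOn 𝓘(ℝ, ℝ) 𝓘(ℝ, E) ∞ γ I)
    {μ : ℝ → CotangentBundle 𝓘(ℝ, Fin (k + 1) → E).tangent
      (TangentBundle 𝓘(ℝ, Fin (k + 1) → E) (HOTangent E Q k))}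
    {σ : ℝ → CotangentBundle 𝓘(ℝ, Fin (k + 1) → E) (HOTangent E Q k)}
    (hμ : ∀ t ∈ I, μ t = tulczyjewAlpha (velocity (cotangentModel 𝓘(ℝ, Fin (k + 1) → E)) σ t))
    (h : ∀ t ∈ I, (μ t).proj = (lift (k + 1) γ t).canonicalImmersion) (ht : t ∈ I) :
    (σ t).proj = lift k γ t := by
  have h1 := h t ht
  rw [hμ t ht, canonicalImmersion_lift (smoothNear_of_contMDiffOn hI hγ ht)] at h1
  exact congrArg TotalSpace.proj h1

/-- The momenta of a solution over the lift of `γ`. -/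
theorem momentum_of_solution (he : e ∈ atlas E Q)
    (hL : ContMDiff 𝓘(ℝ, Fin (k + 1 + 1) → E) 𝓘(ℝ, ℝ) ∞ L) (hI : IsOpen I)
    (hγ : ContMDiffOn 𝓘(ℝ, ℝ) 𝓘(ℝ, E) ∞ γ I)
    {σ : ℝ → CotangentBundle 𝓘(ℝ, Fin (k + 1) → E) (HOTangent E Q k)}
    (hσ : ContMDiffOn 𝓘(ℝ, ℝ) (cotangentModel 𝓘(ℝ, Fin (k + 1) → E)) ∞ σ I)
    (hN : ∀ t ∈ I, velocity (cotangentModel 𝓘(ℝ, Fin (k + 1) → E)) σ t ∈ dynamicsSubmanifold L)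
    (hσγ : ∀ t ∈ I, (σ t).proj = lift k γ t) (ht : t ∈ I) (hte : γ t ∈ e.source) :
    ostrogradsky (forceAlong L e he γ) (k + 1 + 1) 0 t = 0 ∧
      momentum (natChart k e he) (σ t) = momentumAlong L e he γ t := by
  refine momentum_eq_momentumAlong he hL (smoothNear_of_contMDiffOn hI hγ ht) hte ?_ ?_ ?_ <;>
    filter_upwards [hI.mem_nhds ht] with s hs
  · exact hσ.contMDiffAt (hI.mem_nhds hs)
  · exact hσγ s hs
  · exact hN s hs

/-- A curve that satisfies the Euler-Lagrange equations comes from a solution. -/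
theorem exists_solution (hL : ContMDiff 𝓘(ℝ, Fin (k + 1 + 1) → E) 𝓘(ℝ, ℝ) ∞ L) (hI : IsOpen I)
    (hγ : ContMDiffOn 𝓘(ℝ, ℝ) 𝓘(ℝ, E) ∞ γ I) (hEL : IsEulerLagrange L I γ) :
    ∃ μ : ℝ → CotangentBundle 𝓘(ℝ, Fin (k + 1) → E).tangent
        (TangentBundle 𝓘(ℝ, Fin (k + 1) → E) (HOTangent E Q k)),
      IsSolution L I μ ∧ ∀ t ∈ I, (μ t).proj = (lift (k + 1) γ t).canonicalImmersion := by
  have hsmooth : ∀ t ∈ I, SmoothNear E γ t := fun t ht => smoothNear_of_contMDiffOn hI hγ ht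
  have h0 : ∀ t ∈ I, ∀ (e : OpenPartialHomeomorph Q E) (he : e ∈ atlas E Q), γ t ∈ e.source →
      ostrogradsky (forceAlong L e he γ) (k + 1 + 1) 0 t = 0 := fun t ht e he hte => by
    rw [ostrogradsky_forceAlong_zero]
    exact hEL t ht e he hte
  -- The chart is chosen anew at each time, so neither the smoothness nor the velocity of `σ` is
  -- visible yet.
  set σ : ℝ → CotangentBundle 𝓘(ℝ, Fin (k + 1) → E) (HOTangent E Q k) := fun t =>
    phaseCurve L (chartAt E (γ t)) (chart_mem_atlas E (γ t)) γ t with hσdef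
  -- The momenta do not depend on the chart. The phase curve built with `e` solves N_L near `t`,
  -- because the Euler–Lagrange equations hold in `e`; read in the preferred chart at `γ t`, it must
  -- therefore have the Jacobi-Ostrogradsky momenta of that chart.
  have hloc : ∀ t ∈ I, ∀ (e : OpenPartialHomeomorph Q E) (he : e ∈ atlas E Q), γ t ∈ e.source →
      σ t = phaseCurve L e he γ t := by
    intro t ht e he hte
    have hc : γ t ∈ (chartAt E (γ t)).source := mem_chart_source E (γ t)
    refine momentum_inj (natChart_mem_maximalAtlas (chart_mem_atlas E (γ t))) ?_ rfl ?_
    · change (lift k γ t).proj ∈ (chartAt E (γ t)).source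
      rwa [proj_lift]
    · rw [hσdef, momentum_phaseCurve _ hc]
      have hγt := hsmooth t ht
      refine ((momentum_eq_momentumAlong (chart_mem_atlas E (γ t)) hL hγt hc
        (σ := phaseCurve L e he γ) ?_ (Eventually.of_forall fun _ => rfl) ?_).2).symm
      · filter_upwards [hI.mem_nhds ht, hγt.eventually_mem hte] with s hs hse
        exact contMDiffAt_phaseCurve he hL (hsmooth s hs) hse
      · filter_upwards [hI.mem_nhds ht, hγt.eventually_mem hte] with s hs hse
        exact velocity_phaseCurve_mem he hL (hsmooth s hs) hse (h0 s hs e he hse)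
  have hev : ∀ t ∈ I, σ =ᶠ[𝓝 t]
      phaseCurve L (chartAt E (γ t)) (chart_mem_atlas E (γ t)) γ := by
    intro t ht
    filter_upwards [hI.mem_nhds ht, (hsmooth t ht).eventually_mem (mem_chart_source E (γ t))]
      with s hs hse
    exact hloc s hs _ _ hse
  have hσ : ∀ t ∈ I, ContMDiffAt 𝓘(ℝ, ℝ) (cotangentModel 𝓘(ℝ, Fin (k + 1) → E)) ∞ σ t :=
    fun t ht => (contMDiffAt_phaseCurve _ hL (hsmooth t ht)
      (mem_chart_source E (γ t))).congr_of_eventuallyEq (hev t ht)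
  have hN : ∀ t ∈ I,
      velocity (cotangentModel 𝓘(ℝ, Fin (k + 1) → E)) σ t ∈ dynamicsSubmanifold L := by
    intro t ht
    rw [velocity_congr _ (hev t ht)]
    exact velocity_phaseCurve_mem _ hL (hsmooth t ht) (mem_chart_source E (γ t))
      (h0 t ht _ _ (mem_chart_source E (γ t)))
  refine ⟨fun t => tulczyjewAlpha (velocity (cotangentModel 𝓘(ℝ, Fin (k + 1) → E)) σ t),
    ⟨fun t ht => (contMDiffAt_tulczyjewAlpha_velocity ?_).contMDiffWithinAt, σ,
      fun t ht => (hσ t ht).contMDiffWithinAt, fun t ht => ⟨hN t ht, rfl⟩⟩, fun t ht => ?_⟩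
  · filter_upwards [hI.mem_nhds ht] with s hs
    exact hσ s hs
  · rw [canonicalImmersion_lift (hsmooth t ht)]
    exact proj_tulczyjewAlpha_velocity (hσ t ht)

end Solutions

end HigherOrder

end

/-! ### Solutions of higher-order Lagrangian systems and the Euler–Lagrange equations -/

theorem mainTheorem6 {E : Type*} [NormedAddCommGroup E] [NormedSpace ℝ E] [FiniteDimensional ℝ E]
    {Q : Type*} [TopologicalSpace Q] [ChartedSpace E Q] [IsManifold 𝓘(ℝ, E) ∞ Q]
    (k : ℕ) (L : HigherOrder.HOTangent E Q (k + 1) → ℝ)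
    (hL : ContMDiff 𝓘(ℝ, Fin (k + 1 + 1) → E) 𝓘(ℝ, ℝ) ∞ L)
    (I : Set ℝ) (hI : IsOpen I) :
    -- every solution is a curve in `Σ_L` over the lift of a smooth curve in `Q`
    (∀ μ : ℝ → HigherOrder.CotangentBundle 𝓘(ℝ, Fin (k + 1) → E).tangent
        (TangentBundle 𝓘(ℝ, Fin (k + 1) → E) (HigherOrder.HOTangent E Q k)),
      HigherOrder.IsSolution L I μ →
        (∀ t ∈ I, μ t ∈ HigherOrder.lagrangianSubmanifold L) ∧
        ∃ γ : ℝ → Q, ContMDiffOn 𝓘(ℝ, ℝ) 𝓘(ℝ, E) ∞ γ I ∧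
          ∀ t ∈ I, (μ t).proj = (HigherOrder.HOTangent.lift (k + 1) γ t).canonicalImmersion) ∧
    -- the curves that occur are the solutions of the higher-order Euler-Lagrange equations, and
    -- each of them comes from exactly one solution
    (∀ γ : ℝ → Q, ContMDiffOn 𝓘(ℝ, ℝ) 𝓘(ℝ, E) ∞ γ I →
      (HigherOrder.IsEulerLagrange L I γ ↔
        ∃ μ : ℝ → HigherOrder.CotangentBundle 𝓘(ℝ, Fin (k + 1) → E).tangent
            (TangentBundle 𝓘(ℝ, Fin (k + 1) → E) (HigherOrder.HOTangent E Q k)),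
          HigherOrder.IsSolution L I μ ∧
          ∀ t ∈ I, (μ t).proj = (HigherOrder.HOTangent.lift (k + 1) γ t).canonicalImmersion) ∧
      ∀ μ ν : ℝ → HigherOrder.CotangentBundle 𝓘(ℝ, Fin (k + 1) → E).tangent
          (TangentBundle 𝓘(ℝ, Fin (k + 1) → E) (HigherOrder.HOTangent E Q k)),
        HigherOrder.IsSolution L I μ → HigherOrder.IsSolution L I ν →
        (∀ t ∈ I, (μ t).proj = (HigherOrder.HOTangent.lift (k + 1) γ t).canonicalImmersion) →
        (∀ t ∈ I, (ν t).proj = (HigherOrder.HOTangent.lift (k + 1) γ t).canonicalImmersion) →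
        EqOn μ ν I) := by
  refine ⟨?_, fun γ hγ => ⟨⟨HigherOrder.exists_solution hL hI hγ, ?_⟩, ?_⟩⟩
  · rintro μ ⟨-, σ, hσ, hN⟩
    have hbase := fun t (ht : t ∈ I) =>
      HigherOrder.proj_eq_lift_of_velocity_mem hI hσ (fun s hs => (hN s hs).1) ht
    -- The curve in Q is the projection of the phase curve σ.
    refine ⟨fun t ht => ?_, fun s => (σ s).proj.proj,
      fun t ht => (hbase t ht).1.self_of_nhds.contMDiffWithinAt, fun t ht => ?_⟩
    · rw [(hN t ht).2]
      exact (hN t ht).1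
    · rw [(hN t ht).2, HigherOrder.HOTangent.canonicalImmersion_lift (hbase t ht).1,
        HigherOrder.proj_tulczyjewAlpha_velocity (hσ.contMDiffAt (hI.mem_nhds ht))]
      refine HigherOrder.velocity_congr _ ?_
      filter_upwards [hI.mem_nhds ht] with s hs
      exact (hbase s hs).2
  · rintro ⟨μ, ⟨-, σ, hσ, hN⟩, hμγ⟩ t ht e he hte
    rw [← HigherOrder.ostrogradsky_forceAlong_zero]
    exact (HigherOrder.momentum_of_solution he hL hI hγ hσ (fun s hs => (hN s hs).1)
      (fun s hs => HigherOrder.proj_eq_lift_of_proj_eq hI hγ (fun r hr => (hN r hr).2) hμγ hs)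
      ht hte).1
  · rintro μ ν ⟨-, σ, hσ, hN⟩ ⟨-, τ, hτ, hN'⟩ hμγ hνγ
    have h1 := fun s (hs : s ∈ I) =>
      HigherOrder.proj_eq_lift_of_proj_eq hI hγ (fun r hr => (hN r hr).2) hμγ hs
    have h2 := fun s (hs : s ∈ I) =>
      HigherOrder.proj_eq_lift_of_proj_eq hI hγ (fun r hr => (hN' r hr).2) hνγ hs
    -- Both phase curves lie over the lift of γ and have its Jacobi-Ostrogradsky momenta, so they
    -- agree on `I`. As `I` is open, their velocities agree as well, and the solutions are the
    -- images of these under α.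
    have heq : ∀ t ∈ I, σ t = τ t := by
      intro t ht
      have he : chartAt E (γ t) ∈ atlas E Q := chart_mem_atlas E (γ t)
      have hte : γ t ∈ (chartAt E (γ t)).source := mem_chart_source E (γ t)
      refine HigherOrder.momentum_inj (HigherOrder.HOTangent.natChart_mem_maximalAtlas he) ?_
        ((h1 t ht).trans (h2 t ht).symm) ?_
      · rw [h1 t ht, HigherOrder.HOTangent.mem_natChart_source, HigherOrder.HOTangent.proj_lift]
        exact hte
      · rw [(HigherOrder.momentum_of_solution he hL hI hγ hσ (fun s hs => (hN s hs).1) h1 ht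
            hte).2, (HigherOrder.momentum_of_solution he hL hI hγ hτ (fun s hs => (hN' s hs).1) h2
            ht hte).2]
    intro t ht
    rw [(hN t ht).2, (hN' t ht).2, HigherOrder.velocity_congr _
      (show σ =ᶠ[𝓝 t] τ from by filter_upwards [hI.mem_nhds ht] with s hs using heq s hs)]
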